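/- **Setting.** Let $n^I>k^I\ge 1$ and $n^F>k^F\ge 1$ be integers, $r^I=n^I-k^I$, $r^F=n^F-k^F$, $M=\operatorname{lcm}(k^I,k^F)$, $\lambda^I=M/k^I$, $\lambda^F=M/k^F$. An $[n,k]$ linear code over a finite field is given with its encoder $m\mapsto mG$ for a $k\times n$ generator matrix $G$; it is *MDS* if any $k$ columns of $G$ are linearly independent, and *systematic* if some $k$ columns of $G$ form the identity matrix. A *linear MDS $(n^I,k^I;n^F,k^F)$ convertible code* over a finite field $\mathbb F$ consists of a linear MDS $[n^I,k^I]$ code $\mathcal C^I$ and a linear MDS $[n^F,k^F]$ code $\mathcal C^F$ over $\mathbb F$; a partition of $\{1,\dots,M\}$ into $\lambda^I$ sets $P^I_i$ of size $k^I$ and a partition into $\lambda^F$ sets $P^F_j$ of size $k^F$; and a conversion procedure which, for every message $m\in\mathbb F^M$, turns the initial stripes $\mathcal C^I(m[P^I_i])$ into the final stripes $\mathcal C^F(m[P^F_j])$. In the procedure each node (symbol of a final stripe) is either an *unchanged* node, i.e. is one of the nodes of the initial stripes (each of which is used for at most one final node), or a *new* node, whose content is a fixed linear combination of the contents of a set $\mathcal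 D$ of initial nodes that are read. The *access cost* is $|\mathcal D|$ plus the number of new nodes. A convertible code is *access-optimal* if its access cost is minimal among all linear MDS convertible codes with the same parameters $(n^I,k^I;n^F,k^F)$, over all finite fields. It is *systematic* if $\mathcal C^I$ and $\mathcal C^F$ both are. A code $\mathcal C^I$ over $\mathbb F$ is *$(n^F,k^F)$-access-optimally convertible* if it is the initial code of some access-optimal $(n^I,k^I;n^F,k^F)$ convertible code over $\mathbb F$. **Theorem.** 1. Let $k^F\le k^I$ and let $\mathcal C^I$ be a systematic linear MDS $[n^I,k^I]$ code over a finite field $\mathbb F$. If $k^F<k^I$ and $r^I<r^F$, assume that a linear MDS $[n^F,k^F]$ code over $\mathbb F$ exists; if $k^F=k^I$ and $n^I<n^F$, assume that $|\mathbb F|>\binom{n^F-1}{k^F-1}$. Then $\mathcal C^I$ is $(n^F,k^F)$-access-optimally convertible. 2. Let $\varsigma\ge 2$ be an integer with $k^F\le\varsigma k^I$, and let $\mathcal C^I$ be the initial code of an access-optimal systematic linear MDS $(n^I,k^I;\ \varsigma k^I+r^F,\ \varsigma k^I)$ convertible code over a finite field $\mathbb F$. If $k^F=k^I$ and $n^I<n^F$,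 assume that $|\mathbb F|>\binom{n^F-1}{k^F-1}$. Then $\mathcal C^I$ is $(n^F,k^F)$-access-optimally convertible. 3. Let $k^I\ne k^F$. Put $R=M$ if $r^I<r^F$ or $r^F\ge\min\{k^I,k^F\}$, and otherwise $$R=\lambda^I r^F+(\lambda^I\bmod\lambda^F)\bigl(k^I-\max\{k^F\bmod k^I,\ r^F\}\bigr).$$ Every linear MDS $(n^I,k^I;n^F,k^F)$ convertible code over a finite field reads at least $R$ nodes and writes at least $\lambda^F r^F$ new nodes, and over some finite field there is a linear MDS $(n^I,k^I;n^F,k^F)$ convertible code that reads exactly $R$ nodes and writes exactly $\lambda^F r^F$ new nodes. -/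

import Mathlib

universe u

namespace ConvertibleCodes

/-- An `[n, k]` linear code with its encoder `m ↦ m ᵥ* G` is given by a generator matrix `G`.
It is MDS if any `k` columns are linearly independent, i.e. any `k` code symbols determine
the message. -/
def IsMDS {F : Type u} [Field F] {k n : ℕ} (G : Matrix (Fin k) (Fin n) F) : Prop :=
  k ≤ n ∧ ∀ s : Finset (Fin n), s.card = k → LinearIndependent F (fun j : s => G.col j)

/-- Every message symbol occurs as a code symbol: suitable `k` columns of the generator matrix
form the identity matrix. -/
def IsSystematic {F : Type u} [Field F] {k n : ℕ} (G : Matrix (Fin k) (Fin n) F) : Prop :=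
  ∃ e : Fin k → Fin n, G.submatrix id e = 1

/-- A partition of the `M` message coordinates into `M / k` blocks of size `k` (for `k ∣ M`).
The `a`-th smallest element of block `i` is `index (i, a)`. -/
structure StripePartition (M k : ℕ) where
  index : Fin (M / k) × Fin k ≃ Fin M
  strictMono : ∀ i, StrictMono fun a => index (i, a)

/-- The projection `m[P_i]` of a message onto the coordinates in block `i`. -/
def StripePartition.project {M k : ℕ} (P : StripePartition M k) {F : Type u} (m : Fin M → F)
    (i : Fin (M / k)) : Fin k → F :=
  fun a => m (P.index (i, a))

/-- Node `(i, j)`, the `j`-th node of stripe `i`, stores the `j`-th symbol of the encoding of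
`m[P_i]`. -/
def StripePartition.content {M k n : ℕ} (P : StripePartition M k) {F : Type u} [Field F]
    (G : Matrix (Fin k) (Fin n) F) (m : Fin M → F) (v : Fin (M / k) × Fin n) : F :=
  Matrix.vecMul (P.project m v.1) G v.2

/-- The number of initial stripes, `lcm(kI, kF) / kI`; with the arguments exchanged, the number
of final stripes. -/
abbrev numStripes (k k' : ℕ) : ℕ := Nat.lcm k k' / k

/-- A linear MDS `(nI, kI; nF, kF)` convertible code over `F`: a pair of codes, a pair of
partitions, and a conversion procedure. Every final node is either an unchanged initial node
(`source v = some w`; one initial node can serve as at most one final node) or a new node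
(`source v = none`), which is a fixed linear combination of the initial nodes that are read. -/
structure ConvertibleCode (F : Type u) [Field F] (nI kI nF kF : ℕ) where
  initialGen : Matrix (Fin kI) (Fin nI) F
  finalGen : Matrix (Fin kF) (Fin nF) F
  initial_mds : IsMDS initialGen
  final_mds : IsMDS finalGen
  initialPart : StripePartition (Nat.lcm kI kF) kI
  finalPart : StripePartition (Nat.lcm kI kF) kF
  source : Fin (Nat.lcm kI kF / kF) × Fin nF → Option (Fin (Nat.lcm kI kF / kI) × Fin nI)
  source_inj : ∀ v v' w, source v = some w → source v' = some w → v = v'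
  readSet : Finset (Fin (Nat.lcm kI kF / kI) × Fin nI)
  coeff : Fin (Nat.lcm kI kF / kF) × Fin nF → Fin (Nat.lcm kI kF / kI) × Fin nI → F
  unchanged_eq : ∀ (m : Fin (Nat.lcm kI kF) → F) v w, source v = some w →
    finalPart.content finalGen m v = initialPart.content initialGen m w
  new_eq : ∀ (m : Fin (Nat.lcm kI kF) → F) v, source v = none →
    finalPart.content finalGen m v =
      ∑ w ∈ readSet, coeff v w * initialPart.content initialGen m w

namespace ConvertibleCode

variable {F : Type u} [Field F] {nI kI nF kF : ℕ}

/-- The new nodes, i.e. the final nodes that have to be written. -/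
def newNodes (C : ConvertibleCode F nI kI nF kF) :
    Finset (Fin (Nat.lcm kI kF / kF) × Fin nF) :=
  Finset.univ.filter fun v => (C.source v).isNone

/-- The number of nodes read plus the number of nodes written. -/
def accessCost (C : ConvertibleCode F nI kI nF kF) : ℕ :=
  C.readSet.card + C.newNodes.card

/-- The access cost is least among all linear MDS convertible codes with the same parameters
`(nI, kI; nF, kF)`, over all finite fields. -/
def IsAccessOptimal (C : ConvertibleCode F nI kI nF kF) : Prop :=
  ∀ (K : Type u) [Field K] [Finite K] (C' : ConvertibleCode K nI kI nF kF),
    C.accessCost ≤ C'.accessCost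

end ConvertibleCode

/-- The code generated by `G` is `(nF, kF)`-access-optimally convertible: it is the initial code
of an access-optimal convertible code over the same field. -/
def AccessOptimallyConvertible {F : Type u} [Field F] {nI kI : ℕ}
    (G : Matrix (Fin kI) (Fin nI) F) (nF kF : ℕ) : Prop :=
  ∃ C : ConvertibleCode F nI kI nF kF, C.initialGen = G ∧ C.IsAccessOptimal

/-- The lower bound on the number of nodes read (for `kI ≠ kF`). -/
def readBound (nI kI nF kF : ℕ) : ℕ :=
  if nI - kI < nF - kF ∨ min kI kF ≤ nF - kF then Nat.lcm kI kF
  else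
    numStripes kI kF * (nF - kF) +
      (numStripes kI kF % numStripes kF kI) * (kI - max (kF % kI) (nF - kF))

/-- The lower bound on the number of nodes written (for `kI ≠ kF`). -/
def writeBound (kI nF kF : ℕ) : ℕ := numStripes kF kI * (nF - kF)

end ConvertibleCodes

/-! The content of a node is the dot product of the message with a fixed vector in `F ^ M`. A
conversion thus says that an unchanged node has the same vector on both sides and that the vector of
a new node lies in the span of the vectors read. Write `r = nF - kF`, `q = kF / kI`, `t = kF % kI`.

Lower bounds for `kI ≠ kF`. A node kept from initial stripe `i` in final stripe `j` has its vector
supported on the symbols common to both stripes. Independence in the stripe of larger dimension then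
allows at most as many kept nodes as common symbols (`card_keptTo_le`). Hence a final stripe keeps
at most `kF` nodes, which bounds writing. For reading, a final stripe is decodable without any `r`
of its nodes. Leaving out unread kept nodes and restricting to stripe `i` shows that the nodes read
there, plus the excess over `r` of its overlap with some final stripe, number at least `kI`
(`exists_le_card_readIn`). Overlaps with one final stripe sum to at most `kF = q * kI + t`, so the
total excess is largest when overlaps are as concentrated as possible (`sum_tsub_le`).

Constructions. The message symbols are the unchanged nodes. Most initial stripes are merged in
groups of `q`; each residual one gives `t` symbols to one final stripe and scatters the rest. Few
reads suffice if the final code is shortened from a systematic MDS code with `r` parities whose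
parity matrix splits into blocks of `kI` rows, each with columns spanned by `r` columns of the
initial generator (`HasMergeParities`). Parity columns of powers have this structure, which gives
attainment over large fields. For `kF < kI` one block is enough, and any systematic MDS code with at
least `r` parities provides it. An access-optimal merging code has it because optimality turns the
lower bounds into equalities (`hasMergeParities`).

For `kI = kF`, puncturing costs nothing, and lengthening needs `kI` reads and `nF - nI` writes. -/

namespace ConvertibleCodes

open Finset

/-! ### MDS codes, shortening and systematic form -/

section MDS

variable {F : Type u} [Field F] {k n : ℕ} {G : Matrix (Fin k) (Fin n) F}

theorem IsMDS.linearIndepOn (h : IsMDS G) {s : Finset (Fin n)} (hs : s.card ≤ k) :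
    LinearIndepOn F G.col (s : Set (Fin n)) := by
  obtain ⟨t, hst, ht⟩ := Finset.exists_superset_card_eq hs (by simpa using h.1)
  have : LinearIndepOn F G.col (t : Set (Fin n)) := h.2 t ht
  exact this.mono (by exact_mod_cast hst)

theorem IsMDS.span_col_eq_top (h : IsMDS G) {s : Finset (Fin n)} (hs : k ≤ s.card) :
    Submodule.span F (G.col '' (s : Set (Fin n))) = ⊤ := by
  obtain ⟨t, hts, ht⟩ := Finset.exists_subset_card_eq hs
  have hspan := (h.2 t ht).span_eq_top_of_card_eq_finrank' (by simp [ht])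
  rw [eq_top_iff, ← hspan]
  apply Submodule.span_mono
  rintro _ ⟨j, rfl⟩
  exact ⟨j, hts j.2, rfl⟩

theorem le_card_of_span_col_eq_top {s : Finset (Fin n)}
    (h : Submodule.span F (G.col '' (s : Set (Fin n))) = ⊤) : k ≤ s.card := by
  classical
  have := finrank_span_finset_le_card (R := F) (s.image G.col)
  rw [Set.finrank, Finset.coe_image, h, finrank_top, Module.finrank_fin_fun] at this
  exact this.trans Finset.card_image_le

/-- A code is MDS iff every nonzero codeword has fewer than `k` zeros. -/
theorem isMDS_iff_card_zeros_lt [DecidableEq F] :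
    IsMDS G ↔ k ≤ n ∧ ∀ x : Fin k → F, x ≠ 0 → #{c | Matrix.vecMul x G c = 0} < k := by
  refine and_congr_right fun hkn => ⟨fun h x hx => ?_, fun h s hs => ?_⟩
  · by_contra! hc
    have htop := IsMDS.span_col_eq_top ⟨hkn, h⟩ hc
    apply hx
    have hle : Submodule.span F (G.col '' ((univ.filter fun c => Matrix.vecMul x G c = 0 :
        Finset (Fin n)) : Set (Fin n))) ≤ LinearMap.ker (dotProductBilin F F x) := by
      rw [Submodule.span_le]
      rintro _ ⟨c, hc, rfl⟩
      exact (Finset.mem_filter.1 hc).2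
    rw [htop] at hle
    funext a
    have := hle (x := Pi.single a 1) trivial
    simpa using this
  · refine linearIndependent_of_top_le_span_of_card_eq_finrank ?_ (by simp [hs])
    by_contra hc
    -- If the `k` columns did not span, a nonzero functional would kill them all; as a message it
    -- gives a nonzero codeword with `k` zeros.
    obtain ⟨f, hf, hle⟩ := Submodule.exists_le_ker_of_lt_top _ (lt_top_iff_ne_top.2 fun h' => hc h'.ge)
    have hfx : ∀ y, f y = (fun a => f (Pi.single a 1)) ⬝ᵥ y := by
      intro y
      conv_lhs => rw [pi_eq_sum_univ' y]
      simp [dotProduct, mul_comm, map_sum]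
    have hx : (fun a => f (Pi.single a 1)) ≠ 0 := by
      intro h0
      apply hf
      ext y
      simp [congrFun h0]
    refine absurd (h _ hx) (not_lt.2 ?_)
    refine hs.ge.trans (Finset.card_le_card fun c hc => ?_)
    have : f (G.col c) = 0 := hle (Submodule.subset_span ⟨⟨c, hc⟩, rfl⟩)
    rw [hfx] at this
    exact Finset.mem_filter.2 ⟨mem_univ _, this⟩

/-- Permuting the message coordinates preserves the MDS property. -/
theorem IsMDS.submatrix_equiv {k' : ℕ} (h : IsMDS G) (σ : Fin k' ≃ Fin k) :
    IsMDS (G.submatrix σ id) := by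
  classical
  obtain rfl : k' = k := by simpa using Fintype.card_congr σ
  rw [isMDS_iff_card_zeros_lt] at h ⊢
  refine ⟨h.1, fun x hx => ?_⟩
  have hx' : x ∘ σ.symm ≠ 0 := fun h0 => hx (by
    funext a
    simpa using congrFun h0 (σ a))
  convert h.2 _ hx' using 3
  rw [Matrix.vecMul, Matrix.vecMul, dotProduct, dotProduct,
    ← Equiv.sum_comp σ fun a => (x ∘ σ.symm) a * _]
  simp

/-- The generator matrix `[I | P]`, with `P` read off from an infinite array. -/
def stdGen (P : ℕ → ℕ → F) (k n : ℕ) : Matrix (Fin k) (Fin n) F :=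
  fun a c => if c.1 < k then (if a.1 = c.1 then 1 else 0) else P a (c - k)

/-- Shortening and puncturing a code with generator matrix `[I | P]`. -/
theorem isMDS_stdGen_mono {P : ℕ → ℕ → F} {k n k' n' : ℕ} (h : IsMDS (stdGen P k n))
    (hk : k' ≤ k) (hkn : k' ≤ n') (hn : n' + k ≤ n + k') : IsMDS (stdGen P k' n') := by
  classical
  rw [isMDS_iff_card_zeros_lt] at h ⊢
  refine ⟨hkn, fun x hx => ?_⟩
  -- Padding `x` with zeros gives a codeword of the long code with the same symbols along `f` and
  -- with `k - k'` further zeros at the systematic positions in `g`, so the zero count drops by that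
  -- amount.
  let y : Fin k → F := fun a => if ha : a.1 < k' then x ⟨a, ha⟩ else 0
  have hy : y ≠ 0 := fun h0 => hx (by
    funext a
    simpa [y] using congrFun h0 ⟨a, a.2.trans_le hk⟩)
  have key := h.2 y hy
  let f : Fin n' → Fin n := fun c =>
    ⟨if c.1 < k' then c.1 else c.1 - k' + k, by have := c.2; split_ifs <;> omega⟩
  have hf : Function.Injective f := by
    intro c c' hcc
    simp only [f, Fin.mk.injEq] at hcc
    ext
    split_ifs at hcc <;> omega
  let g : Fin (k - k') → Fin n := fun c => ⟨k' + c, by have := c.2; omega⟩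
  have hg : Function.Injective g := by
    intro c c' hcc
    simp only [g, Fin.mk.injEq] at hcc
    ext
    omega
  have hsum : ∀ z : Fin k → F, ∑ a, y a * z a = ∑ a : Fin k', x a * z (Fin.castLE hk a) := by
    intro z
    have h1 : ∑ a : Fin k', x a * z (Fin.castLE hk a) =
        ∑ a ∈ univ.map (Fin.castLEEmb hk), y a * z a := by
      rw [Finset.sum_map]
      refine Finset.sum_congr rfl fun a _ => ?_
      simp [y]
    rw [h1]
    refine (Finset.sum_subset (subset_univ _) fun a _ ha => ?_).symm
    have : ¬ a.1 < k' := fun hlt => ha (Finset.mem_map.2 ⟨⟨a, hlt⟩, mem_univ _, rfl⟩)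
    simp [y, this]
  have hval : ∀ c, Matrix.vecMul y (stdGen P k n) (f c) = Matrix.vecMul x (stdGen P k' n') c := by
    intro c
    simp only [Matrix.vecMul, dotProduct, hsum]
    refine Finset.sum_congr rfl fun a _ => ?_
    by_cases hc : c.1 < k'
    · have : c.1 < k := by omega
      simp [stdGen, f, hc, this]
    · simp [stdGen, f, hc]
  have hzero : ∀ c, Matrix.vecMul y (stdGen P k n) (g c) = 0 := by
    intro c
    simp only [Matrix.vecMul, dotProduct, hsum]
    refine Finset.sum_eq_zero fun a _ => ?_
    have h1 : k' + c.1 < k := by have := c.2; omega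
    have h2 : a.1 ≠ k' + c.1 := by have := a.2; omega
    simp [stdGen, g, h1, h2]
  have hsub : (univ.filter fun c => Matrix.vecMul x (stdGen P k' n') c = 0).image f ∪
      univ.image g ⊆ univ.filter fun c => Matrix.vecMul y (stdGen P k n) c = 0 := by
    intro c hc
    rcases Finset.mem_union.1 hc with hc | hc
    · obtain ⟨c', hc', rfl⟩ := Finset.mem_image.1 hc
      exact Finset.mem_filter.2 ⟨mem_univ _, (hval c').trans (Finset.mem_filter.1 hc').2⟩
    · obtain ⟨c, hc, rfl⟩ := Finset.mem_image.1 hc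
      simp [hzero]
  have hdisj : Disjoint ((univ.filter fun c => Matrix.vecMul x (stdGen P k' n') c = 0).image f)
      (univ.image g) := by
    rw [Finset.disjoint_left]
    intro c hc hc'
    obtain ⟨c1, -, rfl⟩ := Finset.mem_image.1 hc
    obtain ⟨c2, -, h2⟩ := Finset.mem_image.1 hc'
    simp only [f, g, Fin.mk.injEq] at h2
    have := c2.2
    split_ifs at h2 <;> omega
  have := Finset.card_le_card hsub
  rw [Finset.card_union_of_disjoint hdisj, Finset.card_image_of_injective _ hf,
    Finset.card_image_of_injective _ hg, Finset.card_fin] at this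
  omega

theorem entry_of_submatrix_eq_one {e : Fin k → Fin n} (he : G.submatrix id e = 1) (a b : Fin k) :
    G a (e b) = if a = b then 1 else 0 := by
  have := congrFun (congrFun he a) b
  simpa [Matrix.one_apply] using this

theorem col_of_submatrix_eq_one {e : Fin k → Fin n} (he : G.submatrix id e = 1) (b : Fin k) :
    G.col (e b) = Pi.single b 1 := by
  funext a
  rw [Pi.single_apply]
  exact entry_of_submatrix_eq_one he a b

theorem injective_of_submatrix_eq_one {e : Fin k → Fin n} (he : G.submatrix id e = 1) :
    Function.Injective e := by
  intro a b hab
  by_contra hne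
  have h1 := entry_of_submatrix_eq_one he a a
  rw [hab, entry_of_submatrix_eq_one he a b] at h1
  simp [hne] at h1

/-- Choosing `r` parities of a systematic MDS code and reordering gives a code `[I | P]`. -/
theorem IsMDS.stdGen_of_systematic (h : IsMDS G) {e : Fin k → Fin n}
    (he : G.submatrix id e = 1) {r : ℕ} {f : Fin r → Fin n} (hf : Function.Injective f)
    (hef : ∀ a v, e a ≠ f v) (P : ℕ → ℕ → F) (hP : ∀ a v, P (a : Fin k) (v : Fin r) = G a (f v)) :
    IsMDS (stdGen P k (k + r)) := by
  classical
  rw [isMDS_iff_card_zeros_lt] at h ⊢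
  refine ⟨by omega, fun x hx => lt_of_le_of_lt ?_ (h.2 x hx)⟩
  let φ : Fin (k + r) → Fin n := Fin.addCases e f
  have hφ : Function.Injective φ := by
    intro c c' hcc
    induction c using Fin.addCases <;> induction c' using Fin.addCases <;>
      simp only [φ, Fin.addCases_left, Fin.addCases_right] at hcc
    · rw [injective_of_submatrix_eq_one he hcc]
    · exact (hef _ _ hcc).elim
    · exact (hef _ _ hcc.symm).elim
    · rw [hf hcc]
  refine Finset.card_le_card_of_injOn φ (fun c hc => ?_) hφ.injOn
  have hc := (Finset.mem_filter.1 hc).2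
  refine Finset.mem_coe.2 (Finset.mem_filter.2 ⟨mem_univ _, ?_⟩)
  rw [← hc]
  simp only [Matrix.vecMul, dotProduct]
  refine Finset.sum_congr rfl fun a _ => ?_
  induction c using Fin.addCases with
  | left c => simp [φ, stdGen, entry_of_submatrix_eq_one he, Fin.ext_iff]
  | right c => simp [φ, stdGen, hP]

/-- A parity array extending finite data. -/
theorem exists_array {k r : ℕ} (p : Fin k → Fin r → F) :
    ∃ P : ℕ → ℕ → F, ∀ a v, P (a : Fin k) (v : Fin r) = p a v :=
  ⟨fun a v => if h : a < k ∧ v < r then p ⟨a, h.1⟩ ⟨v, h.2⟩ else 0, fun a v => by simp⟩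

/-- Positions outside the systematic ones. -/
theorem exists_parity_positions {e : Fin k → Fin n} {r : ℕ} (hr : k + r ≤ n) :
    ∃ f : Fin r → Fin n, Function.Injective f ∧ ∀ a v, e a ≠ f v := by
  classical
  have hcard : r ≤ ((univ.image e)ᶜ).card := by
    rw [Finset.card_compl, Fintype.card_fin]
    have := Finset.card_image_le (s := (univ : Finset (Fin k))) (f := e)
    rw [Finset.card_fin] at this
    omega
  obtain ⟨t, ht, htr⟩ := Finset.exists_subset_card_eq hcard
  refine ⟨fun v => t.orderEmbOfFin htr v, fun v v' hv => by simpa using hv, fun a v hav => ?_⟩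
  have := ht (t.orderEmbOfFin_mem htr v)
  rw [← show e a = t.orderEmbOfFin htr v from hav] at this
  simp at this

/-- Every MDS code has a generator matrix `[I | P]`, up to a change of the message basis. -/
theorem IsMDS.exists_stdGen (h : IsMDS G) : ∃ P : ℕ → ℕ → F, IsMDS (stdGen P k n) := by
  classical
  let e : Fin k → Fin n := Fin.castLE h.1
  let A : Matrix (Fin k) (Fin k) F := G.submatrix id e
  have hA : IsUnit A := by
    rw [← Matrix.linearIndependent_cols_iff_isUnit]
    have h1 := h.linearIndepOn (s := univ.map (Fin.castLEEmb h.1)) (by simp)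
    have h2 : LinearIndepOn F G.col (Set.range e) := h1.mono (by
      rintro _ ⟨a, rfl⟩
      exact Finset.mem_coe.2 (Finset.mem_map.2 ⟨a, mem_univ _, rfl⟩))
    exact (linearIndepOn_range_iff (Fin.castLE_injective h.1) _).1 h2
  have hAi : A⁻¹ * A = 1 := Matrix.nonsing_inv_mul A ((Matrix.isUnit_iff_isUnit_det A).1 hA)
  have hAi' : A * A⁻¹ = 1 := Matrix.mul_nonsing_inv A ((Matrix.isUnit_iff_isUnit_det A).1 hA)
  have hH : IsMDS (A⁻¹ * G) := by
    rw [isMDS_iff_card_zeros_lt] at h ⊢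
    refine ⟨h.1, fun x hx => ?_⟩
    rw [← Matrix.vecMul_vecMul]
    refine h.2 _ fun h0 => hx ?_
    have := congrArg (fun y => Matrix.vecMul y A) h0
    simpa [Matrix.vecMul_vecMul, hAi] using this
  have he : (A⁻¹ * G).submatrix id e = 1 := by
    rw [← hAi]
    ext a b
    simp [Matrix.mul_apply, A]
  obtain ⟨f, hf, hef⟩ := exists_parity_positions (e := e) (r := n - k) (by have := h.1; omega)
  obtain ⟨P, hP⟩ := exists_array fun a v => (A⁻¹ * G) a (f v)
  refine ⟨P, ?_⟩
  have := hH.stdGen_of_systematic he hf hef P hP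
  rwa [Nat.add_sub_cancel' h.1] at this

end MDS

/-! ### Lengthening MDS codes over large fields -/

section Extension

variable {F : Type u} [Field F] {k n : ℕ}

/-- Appending a column outside all hyperplanes spanned by `k - 1` columns of an MDS code. -/
theorem IsMDS.append {G : Matrix (Fin k) (Fin n) F} (h : IsMDS G)
    {H : Matrix (Fin k) (Fin (n + 1)) F} (hH : ∀ c : Fin n, H.col c.castSucc = G.col c)
    (hlast : ∀ s : Finset (Fin n), s.card = k - 1 →
      H.col (Fin.last n) ∉ Submodule.span F (G.col '' (s : Set (Fin n)))) : IsMDS H := by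
  classical
  refine ⟨by have := h.1; omega, fun s hs => ?_⟩
  change LinearIndepOn F H.col (s : Set (Fin (n + 1)))
  let t : Finset (Fin n) := univ.filter fun c => c.castSucc ∈ s
  have himg : Fin.castSucc '' (t : Set (Fin n)) = (s.erase (Fin.last n) : Set (Fin (n + 1))) := by
    ext c
    induction c using Fin.lastCases with
    | last => simp
    | cast c => simp [t]
  have himg' : t.map Fin.castSuccEmb = s.erase (Fin.last n) := by
    apply Finset.coe_injective
    rw [Finset.coe_map, ← himg]
    rfl
  have hcomp : H.col ∘ Fin.castSucc = G.col := funext hH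
  have htk : t.card ≤ k := by
    rw [← Finset.card_map Fin.castSuccEmb, himg', ← hs]
    exact Finset.card_le_card (Finset.erase_subset _ _)
  have hind : LinearIndepOn F H.col (s.erase (Fin.last n) : Set (Fin (n + 1))) := by
    rw [← himg]
    refine LinearIndepOn.image_of_comp (f := Fin.castSucc) (g := H.col) ?_
    rw [hcomp]
    exact h.linearIndepOn htk
  by_cases hl : Fin.last n ∈ s
  · have htc : t.card = k - 1 := by
      rw [← Finset.card_map Fin.castSuccEmb, himg', Finset.card_erase_of_mem hl, hs]
    rw [← Finset.insert_erase hl, Finset.coe_insert, linearIndepOn_insert (by simp)]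
    refine ⟨hind, ?_⟩
    rw [← himg, ← Set.image_comp, hcomp]
    exact hlast t htc
  · rwa [Finset.erase_eq_of_notMem hl] at hind

theorem IsMDS.span_col_ne_top {G : Matrix (Fin k) (Fin n) F} (hk : 0 < k) {s : Finset (Fin n)}
    (hs : s.card = k - 1) : Submodule.span F (G.col '' (s : Set (Fin n))) ≠ ⊤ := fun h => by
  have := le_card_of_span_col_eq_top h
  omega

/-- Over a field with more than `(n' - 1).choose (k - 1)` elements, an MDS code of length
`n ≤ n'` extends to one of length `n'`. -/
theorem IsMDS.exists_extension [Finite F] (hk : 0 < k) {G : Matrix (Fin k) (Fin n) F}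
    (h : IsMDS G) {n' : ℕ} (hn : n ≤ n') (hF : (n' - 1).choose (k - 1) < Nat.card F) :
    ∃ H : Matrix (Fin k) (Fin n') F, IsMDS H ∧ ∀ c : Fin n, H.col (Fin.castLE hn c) = G.col c := by
  classical
  induction n', hn using Nat.le_induction with
  | base => exact ⟨G, h, fun c => rfl⟩
  | succ n' hn ih =>
    obtain ⟨H, hH, hHG⟩ := ih ((Nat.choose_le_choose _ (by omega)).trans_lt hF)
    have : Fintype F := Fintype.ofFinite F
    obtain ⟨y, hy⟩ : ∃ y : Fin k → F, ∀ s : Finset (Fin n'), s.card = k - 1 →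
        y ∉ Submodule.span F (H.col '' (s : Set (Fin n'))) := by
      by_contra! hcon
      -- There are `n'.choose (k - 1)` spans, each with at most `|F| ^ (k - 1)` vectors; if they
      -- covered `F ^ k`, then `|F|` would be at most the binomial coefficient.
      have hcover : (univ : Finset (Fin k → F)) ⊆ (powersetCard (k - 1) univ).biUnion
          fun s : Finset (Fin n') =>
            univ.filter fun y => y ∈ Submodule.span F (H.col '' (s : Set (Fin n'))) := by
        intro y _
        obtain ⟨s, hs, hys⟩ := hcon y
        exact Finset.mem_biUnion.2 ⟨s, Finset.mem_powersetCard_univ.2 hs,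
          Finset.mem_filter.2 ⟨mem_univ _, hys⟩⟩
      have hle := (Finset.card_le_card hcover).trans (Finset.card_biUnion_le_card_mul _ _
        (Fintype.card F ^ (k - 1)) fun s hs => ?_)
      · rw [Finset.card_univ, Fintype.card_fun, Fintype.card_fin, Finset.card_powersetCard,
          Finset.card_univ, Fintype.card_fin] at hle
        have hpow : Fintype.card F ^ k = Fintype.card F * Fintype.card F ^ (k - 1) := by
          rw [← pow_succ', Nat.sub_add_cancel hk]
        rw [hpow] at hle
        have := Nat.le_of_mul_le_mul_right hle (pow_pos Fintype.card_pos _)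
        rw [Nat.card_eq_fintype_card, Nat.add_sub_cancel] at hF
        omega
      · rw [Finset.mem_powersetCard_univ] at hs
        rw [← Fintype.card_subtype]
        refine (le_of_eq (?_ : _ = Nat.card F ^ Module.finrank F
          (Submodule.span F (H.col '' (s : Set (Fin n')))))).trans ?_
        · rw [← Nat.card_eq_fintype_card]
          exact Module.natCard_eq_pow_finrank
        · rw [Nat.card_eq_fintype_card]
          refine Nat.pow_le_pow_right Fintype.card_pos ?_
          have h1 := finrank_span_finset_le_card (R := F) (s.image H.col)
          rw [Set.finrank, Finset.coe_image] at h1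
          exact (h1.trans Finset.card_image_le).trans hs.le
    refine ⟨Matrix.of fun a => Fin.snoc (H a) (y a), hH.append (fun c => ?_) fun s hs => ?_,
      fun c => ?_⟩
    · funext a; simp [Matrix.col, Matrix.transpose]
    · convert hy s hs using 2
      funext a; simp [Matrix.col, Matrix.transpose]
    · rw [← hHG]
      funext a
      exact Fin.snoc_castSucc (α := fun _ => F) _ _ (Fin.castLE hn c)

/-- Over large fields there is a vector `(1, x, x ^ 2, …)` outside all hyperplanes spanned by
`k - 1` columns. -/
theorem exists_powers_notMem_span [Finite F] (hk : 0 < k) (G : Matrix (Fin k) (Fin n) F)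
    (hF : 2 ^ n * k < Nat.card F) : ∃ x : F, ∀ s : Finset (Fin n), s.card = k - 1 →
      (fun a : Fin k => x ^ a.1) ∉ Submodule.span F (G.col '' (s : Set (Fin n))) := by
  classical
  have : Fintype F := Fintype.ofFinite F
  by_contra! hcon
  have hcover : (univ : Finset F) ⊆ (powersetCard (k - 1) univ).biUnion
      fun s : Finset (Fin n) => univ.filter fun x =>
        (fun a : Fin k => x ^ a.1) ∈ Submodule.span F (G.col '' (s : Set (Fin n))) := by
    intro x _
    obtain ⟨s, hs, hxs⟩ := hcon x
    exact Finset.mem_biUnion.2 ⟨s, Finset.mem_powersetCard_univ.2 hs,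
      Finset.mem_filter.2 ⟨mem_univ _, hxs⟩⟩
  have hle := (Finset.card_le_card hcover).trans (Finset.card_biUnion_le_card_mul _ _ k
    fun s hs => ?_)
  · rw [Finset.card_univ, Finset.card_powersetCard, Finset.card_univ, Fintype.card_fin] at hle
    rw [Nat.card_eq_fintype_card] at hF
    have := Nat.mul_le_mul_right k (Nat.choose_le_two_pow n (k - 1))
    omega
  · rw [Finset.mem_powersetCard_univ] at hs
    obtain ⟨f, hf, hle⟩ := Submodule.exists_le_ker_of_lt_top _
      (lt_top_iff_ne_top.2 (IsMDS.span_col_ne_top (G := G) hk hs))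
    -- A functional killing the span turns membership of `(1, x, x ^ 2, …)` into `x` being a root of
    -- a fixed nonzero polynomial, so each span excludes at most `k` points.
    let p : Polynomial F := ∑ a : Fin k, Polynomial.monomial a.1 (f (Pi.single a 1))
    have hcoeff : ∀ a : Fin k, p.coeff a = f (Pi.single a 1) := by
      intro a
      simp [p, Polynomial.coeff_monomial, Fin.val_inj]
    have hp : p ≠ 0 := fun h0 => hf (by
      ext a
      simpa [h0] using (hcoeff a).symm)
    have heval : ∀ x, p.eval x = f fun a : Fin k => x ^ a.1 := by
      intro x
      rw [pi_eq_sum_univ' fun a : Fin k => x ^ a.1]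
      simp [p, Polynomial.eval_finsetSum, map_sum, mul_comm]
    have hdeg : p.natDegree ≤ k := by
      refine Polynomial.natDegree_sum_le_of_forall_le _ _ fun a _ => ?_
      exact (Polynomial.natDegree_monomial_le _).trans a.2.le
    refine le_trans ?_ ((Multiset.toFinset_card_le p.roots).trans (p.card_roots'.trans hdeg))
    refine Finset.card_le_card fun x hx => ?_
    rw [Multiset.mem_toFinset, Polynomial.mem_roots hp, Polynomial.IsRoot, heval]
    exact hle (Finset.mem_filter.1 hx).2

/-- Over large fields, suitable points make the code `[I | (θ v ^ a)]` MDS. -/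
theorem exists_isMDS_powers [Finite F] (hk : 0 < k) (r : ℕ)
    (hF : 2 ^ (k + r) * k < Nat.card F) :
    ∃ θ : ℕ → F, IsMDS (stdGen (fun a v => θ v ^ a) k (k + r)) := by
  classical
  induction r with
  | zero =>
    refine ⟨0, isMDS_iff_card_zeros_lt.2 ⟨le_rfl, fun x hx => ?_⟩⟩
    refine lt_of_lt_of_eq (Finset.card_lt_univ_of_notMem (x := ?_) ?_) (Fintype.card_fin _)
    · exact (Function.ne_iff.1 hx).choose
    · intro hc
      apply (Function.ne_iff.1 hx).choose_spec
      simpa [Matrix.vecMul, dotProduct, stdGen, Fin.val_inj] using hc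
  | succ r ih =>
    have hle : 2 ^ (k + r) * k ≤ 2 ^ (k + (r + 1)) * k :=
      Nat.mul_le_mul_right _ (Nat.pow_le_pow_right (by omega) (by omega))
    obtain ⟨θ, hθ⟩ := ih (hle.trans_lt hF)
    obtain ⟨x, hx⟩ := exists_powers_notMem_span hk (stdGen (fun a v => θ v ^ a) k (k + r))
      (hle.trans_lt hF)
    refine ⟨Function.update θ r x, hθ.append (fun c => ?_) fun s hs => ?_⟩
    · funext a
      have h1 : c.1 - k ≠ r ∨ c.1 < k := by have := c.2; omega
      rcases h1 with h1 | h1 <;> simp [Matrix.col, Matrix.transpose, stdGen, h1]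
    · convert hx s hs using 2
      funext a
      simp [Matrix.col, Matrix.transpose, stdGen]

end Extension

/-! ### Nodes as vectors in the message space -/

namespace StripePartition

variable {F : Type u} [Field F] {M k n : ℕ}

/-- The restriction of a vector of length `M` to block `i`. -/
def restrict (P : StripePartition M k) (F : Type u) [Field F] (i : Fin (M / k)) :
    (Fin M → F) →ₗ[F] (Fin k → F) :=
  LinearMap.funLeft F F fun a => P.index (i, a)

/-- Extension by zero from block `i`. -/
def extend (P : StripePartition M k) (F : Type u) [Field F] (i : Fin (M / k)) :
    (Fin k → F) →ₗ[F] (Fin M → F) where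
  toFun x p := if (P.index.symm p).1 = i then x (P.index.symm p).2 else 0
  map_add' x y := by ext p; simp only [Pi.add_apply]; split_ifs <;> simp
  map_smul' c x := by ext p; simp

/-- The content of node `v` is the dot product of the message with this vector. -/
def vec (P : StripePartition M k) (G : Matrix (Fin k) (Fin n) F) (v : Fin (M / k) × Fin n) :
    Fin M → F :=
  P.extend F v.1 (G.col v.2)

@[simp] theorem restrict_apply (P : StripePartition M k) (i : Fin (M / k)) (x : Fin M → F)
    (a : Fin k) : P.restrict F i x a = x (P.index (i, a)) := rfl

theorem extend_apply (P : StripePartition M k) (i : Fin (M / k)) (x : Fin k → F)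
    (p : Fin M) : P.extend F i x p = if (P.index.symm p).1 = i then x (P.index.symm p).2 else 0 :=
  rfl

theorem extend_index (P : StripePartition M k) (i j : Fin (M / k)) (x : Fin k → F)
    (a : Fin k) : P.extend F i x (P.index (j, a)) = if j = i then x a else 0 := by
  simp [extend_apply]

@[simp] theorem restrict_extend_self (P : StripePartition M k) (i : Fin (M / k)) (x : Fin k → F) :
    P.restrict F i (P.extend F i x) = x := by
  funext a
  simp [extend_apply]

theorem restrict_extend_of_ne (P : StripePartition M k) {i j : Fin (M / k)} (h : j ≠ i)
    (x : Fin k → F) : P.restrict F j (P.extend F i x) = 0 := by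
  funext a
  simp [extend_apply, h]

theorem extend_injective (P : StripePartition M k) (i : Fin (M / k)) :
    Function.Injective (P.extend F i) :=
  Function.LeftInverse.injective (P.restrict_extend_self i)

theorem sum_extend_restrict (P : StripePartition M k) (x : Fin M → F) :
    ∑ i, P.extend F i (P.restrict F i x) = x := by
  funext p
  rw [Finset.sum_apply, Finset.sum_eq_single (P.index.symm p).1]
  · simp [extend_apply]
  · intro i _ hi
    simp [extend_apply, hi.symm]
  · simp

theorem extend_single (P : StripePartition M k) (i : Fin (M / k)) (a : Fin k) :
    P.extend F i (Pi.single a 1) = Pi.single (P.index (i, a)) 1 := by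
  funext p
  obtain ⟨⟨j, b⟩, rfl⟩ := P.index.surjective p
  simp only [extend_index, Pi.single_apply, P.index.injective.eq_iff, Prod.mk.injEq]
  by_cases h : j = i <;> simp [h]

theorem content_eq_dotProduct (P : StripePartition M k) (G : Matrix (Fin k) (Fin n) F)
    (m : Fin M → F) (v : Fin (M / k) × Fin n) : P.content G m v = m ⬝ᵥ P.vec G v := by
  rw [content, Matrix.vecMul, dotProduct, dotProduct, ← P.index.sum_comp, Fintype.sum_prod_type,
    Finset.sum_eq_single v.1]
  · simp [vec, extend_index, project]
  · intro i _ hi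
    simp [vec, extend_index, hi]
  · simp

/-- Nodes of one stripe of an MDS code are independent as long as there are at most `k`. -/
theorem linearIndepOn_vec (P : StripePartition M k) {G : Matrix (Fin k) (Fin n) F} (h : IsMDS G)
    (i : Fin (M / k)) {s : Finset (Fin n)} (hs : s.card ≤ k) :
    LinearIndepOn F (fun c => P.vec G (i, c)) (s : Set (Fin n)) :=
  LinearIndepOn.map_injOn (h.linearIndepOn hs) (P.extend F i) (P.extend_injective i).injOn

/-- Vectors can be tested for membership in a span of nodes stripe by stripe. -/
theorem mem_span_vec (P : StripePartition M k) {G : Matrix (Fin k) (Fin n) F} {x : Fin M → F}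
    {D : Fin (M / k) → Finset (Fin n)}
    (h : ∀ i, P.restrict F i x ∈ Submodule.span F (G.col '' (D i : Set (Fin n)))) :
    x ∈ Submodule.span F (P.vec G '' {w | w.2 ∈ D w.1}) := by
  rw [← P.sum_extend_restrict x]
  refine Submodule.sum_mem _ fun i _ => ?_
  have := Submodule.mem_map_of_mem (f := P.extend F i) (h i)
  rw [Submodule.map_span, ← Set.image_comp] at this
  refine Submodule.span_mono ?_ this
  rintro _ ⟨c, hc, rfl⟩
  exact ⟨(i, c), hc, rfl⟩

end StripePartition

namespace ConvertibleCode

variable {F : Type u} [Field F] {nI kI nF kF : ℕ} (C : ConvertibleCode F nI kI nF kF)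

/-- The message is arbitrary, so equality of contents is equality of linear functionals. This and
the next lemma are the only access to the conversion procedure in the lower bounds. -/
theorem vec_eq_of_source {v w} (h : C.source v = some w) :
    C.finalPart.vec C.finalGen v = C.initialPart.vec C.initialGen w := by
  apply dotProduct_eq
  intro m
  have := C.unchanged_eq m v w h
  rwa [StripePartition.content_eq_dotProduct, StripePartition.content_eq_dotProduct,
    dotProduct_comm, dotProduct_comm m] at this

theorem vec_eq_of_source_none {v} (h : C.source v = none) :
    C.finalPart.vec C.finalGen v =
      ∑ w ∈ C.readSet, C.coeff v w • C.initialPart.vec C.initialGen w := by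
  apply dotProduct_eq
  intro m
  have := C.new_eq m v h
  rw [StripePartition.content_eq_dotProduct, dotProduct_comm] at this
  rw [this, dotProduct_comm, dotProduct_sum]
  refine Finset.sum_congr rfl fun w _ => ?_
  rw [StripePartition.content_eq_dotProduct, dotProduct_smul, smul_eq_mul]

end ConvertibleCode

/-! ### Building convertible codes from vectors -/

/-- A convertible code can be given by the vectors of its nodes. -/
theorem exists_convertibleCode {F : Type u} [Field F] {nI kI nF kF : ℕ}
    {G : Matrix (Fin kI) (Fin nI) F} {H : Matrix (Fin kF) (Fin nF) F} (hG : IsMDS G) (hH : IsMDS H)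
    (PI : StripePartition (Nat.lcm kI kF) kI) (PF : StripePartition (Nat.lcm kI kF) kF)
    (source : Fin (Nat.lcm kI kF / kF) × Fin nF → Option (Fin (Nat.lcm kI kF / kI) × Fin nI))
    (source_inj : ∀ v v' w, source v = some w → source v' = some w → v = v')
    (D : Finset (Fin (Nat.lcm kI kF / kI) × Fin nI))
    (hold : ∀ v w, source v = some w → PF.vec H v = PI.vec G w)
    (hnew : ∀ v, source v = none →
      PF.vec H v ∈ Submodule.span F (PI.vec G '' (D : Set (Fin (Nat.lcm kI kF / kI) × Fin nI)))) :
    ∃ C : ConvertibleCode F nI kI nF kF, C.initialGen = G ∧ C.readSet = D ∧ C.source = source := by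
  have hc : ∀ v, ∃ c : Fin (Nat.lcm kI kF / kI) × Fin nI → F, source v = none →
      PF.vec H v = ∑ w ∈ D, c w • PI.vec G w := by
    intro v
    by_cases hv : source v = none
    · obtain ⟨c, hc⟩ := (Submodule.mem_span_image_finset_iff_exists_fun F).1 (hnew v hv)
      refine ⟨fun w => if h : w ∈ D then c ⟨w, h⟩ else 0, fun _ => ?_⟩
      rw [← hc, ← Finset.sum_coe_sort D]
      exact Finset.sum_congr rfl fun w _ => by simp
    · exact ⟨0, fun h => (hv h).elim⟩
  choose c hc using hc
  refine ⟨⟨G, H, hG, hH, PI, PF, source, source_inj, D, c, fun m v w h => ?_, fun m v h => ?_⟩,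
    rfl, rfl, rfl⟩
  · rw [StripePartition.content_eq_dotProduct, StripePartition.content_eq_dotProduct, hold v w h]
  · rw [StripePartition.content_eq_dotProduct, hc v h, dotProduct_sum]
    refine Finset.sum_congr rfl fun w _ => ?_
    rw [StripePartition.content_eq_dotProduct, dotProduct_smul, smul_eq_mul]

/-- A convertible code whose unchanged nodes are the message symbols, stored as systematic nodes
on both sides. -/
theorem exists_systematic_convertibleCode {F : Type u} [Field F] {nI kI nF kF : ℕ}
    {G : Matrix (Fin kI) (Fin nI) F} {e : Fin kI → Fin nI} {P : ℕ → ℕ → F}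
    (hG : IsMDS G) (he : G.submatrix id e = 1) (hP : IsMDS (stdGen P kF nF))
    (PI : StripePartition (Nat.lcm kI kF) kI) (PF : StripePartition (Nat.lcm kI kF) kF)
    (D : Finset (Fin (Nat.lcm kI kF / kI) × Fin nI))
    (hD : ∀ v : Fin (Nat.lcm kI kF / kF) × Fin nF, kF ≤ v.2.1 →
      PF.vec (stdGen P kF nF) v ∈
        Submodule.span F (PI.vec G '' (D : Set (Fin (Nat.lcm kI kF / kI) × Fin nI)))) :
    ∃ C : ConvertibleCode F nI kI nF kF, C.initialGen = G ∧ C.readSet = D ∧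
      C.newNodes.card = numStripes kF kI * (nF - kF) := by
  classical
  let node : Fin (Nat.lcm kI kF) → Fin (Nat.lcm kI kF / kI) × Fin nI :=
    fun p => ((PI.index.symm p).1, e (PI.index.symm p).2)
  have hnode : Function.Injective node := by
    intro p p' h
    apply PI.index.symm.injective
    ext1
    · exact (Prod.ext_iff.1 h).1
    · exact injective_of_submatrix_eq_one he (Prod.ext_iff.1 h).2
  let source : Fin (Nat.lcm kI kF / kF) × Fin nF → Option (Fin (Nat.lcm kI kF / kI) × Fin nI) :=
    fun v => if h : v.2.1 < kF then some (node (PF.index (v.1, ⟨v.2, h⟩))) else none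
  have hsource : ∀ v w, source v = some w →
      ∃ h : v.2.1 < kF, node (PF.index (v.1, ⟨v.2, h⟩)) = w := by
    intro v w hvw
    by_cases h : v.2.1 < kF
    · exact ⟨h, by simpa [source, h] using hvw⟩
    · simp [source, h] at hvw
  have source_inj : ∀ v v' w, source v = some w → source v' = some w → v = v' := by
    intro v v' w hv hv'
    obtain ⟨h, hw⟩ := hsource v w hv
    obtain ⟨h', hw'⟩ := hsource v' w hv'
    have := PF.index.injective (hnode (hw.trans hw'.symm))
    simp only [Prod.mk.injEq, Fin.mk.injEq] at this
    exact Prod.ext this.1 (Fin.ext this.2)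
  have hold : ∀ v w, source v = some w → PF.vec (stdGen P kF nF) v = PI.vec G w := by
    intro v w hv
    obtain ⟨h, rfl⟩ := hsource v w hv
    have hcol : (stdGen P kF nF).col v.2 = Pi.single ⟨v.2, h⟩ 1 := by
      funext a
      simp [Matrix.col, Matrix.transpose, stdGen, h, Pi.single_apply, Fin.ext_iff]
    rw [StripePartition.vec, hcol, StripePartition.extend_single, StripePartition.vec,
      col_of_submatrix_eq_one he, StripePartition.extend_single]
    exact congrArg (fun p => (Pi.single p 1 : _ → F)) (PI.index.apply_symm_apply _).symm
  obtain ⟨C, h1, h2, h3⟩ := exists_convertibleCode hG hP PI PF source source_inj D hold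
    fun v hv => hD v (by
      by_contra hlt
      simp [source, not_le.1 hlt] at hv)
  refine ⟨C, h1, h2, ?_⟩
  have : C.newNodes = univ ×ˢ (univ.filter fun c : Fin nF => ¬ c.1 < kF) := by
    ext v
    simp [ConvertibleCode.newNodes, h3, source]
  rw [this, Finset.card_product, Finset.card_univ, Fintype.card_fin, numStripes, Nat.lcm_comm]
  congr 1
  have hcount := Finset.card_filter_add_card_filter_not (s := (univ : Finset (Fin nF)))
    (p := fun c : Fin nF => c.1 < kF)
  rw [Fin.card_filter_val_lt, Finset.card_univ, Fintype.card_fin, min_eq_right hP.1] at hcount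
  omega

/-- The contiguous partition. -/
def contiguousPartition {M k : ℕ} (h : k ∣ M) : StripePartition M k where
  index := finProdFinEquiv.trans (finCongr (Nat.div_mul_cancel h))
  strictMono i a b hab := by
    simp only [Fin.lt_def] at hab ⊢
    simp [finProdFinEquiv]
    omega

theorem contiguousPartition_index {M k : ℕ} (h : k ∣ M) (i : Fin (M / k)) (a : Fin k) :
    ((contiguousPartition h).index (i, a)).1 = i * k + a := by
  simp [contiguousPartition, finProdFinEquiv]
  ring

/-- Reading all message symbols suffices for any conversion. -/
theorem exists_convertibleCode_card_readSet_le_lcm {F : Type u} [Field F] {nI kI nF kF : ℕ}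
    {G : Matrix (Fin kI) (Fin nI) F} (hG : IsMDS G) (hs : IsSystematic G)
    {H : Matrix (Fin kF) (Fin nF) F} (hH : IsMDS H) :
    ∃ C : ConvertibleCode F nI kI nF kF, C.initialGen = G ∧ C.readSet.card ≤ Nat.lcm kI kF ∧
      C.newNodes.card = numStripes kF kI * (nF - kF) := by
  classical
  obtain ⟨e, he⟩ := hs
  obtain ⟨P, hP⟩ := hH.exists_stdGen
  let PI := contiguousPartition (Nat.dvd_lcm_left kI kF)
  have htop : Submodule.span F (G.col '' (univ.image e : Finset (Fin nI))) = ⊤ :=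
    hG.span_col_eq_top (by
      rw [Finset.card_image_of_injective _ (injective_of_submatrix_eq_one he), Finset.card_fin])
  have hspan : ∀ x, x ∈ Submodule.span F (PI.vec G '' (univ ×ˢ univ.image e :
      Finset (Fin (Nat.lcm kI kF / kI) × Fin nI))) := by
    intro x
    refine Submodule.span_mono ?_
      (PI.mem_span_vec (G := G) (D := fun _ => univ.image e) fun i => ?_)
    · apply Set.image_mono
      intro w hw
      exact Finset.mem_coe.2 (Finset.mem_product.2 ⟨mem_univ _, hw⟩)
    · rw [htop]
      trivial
  obtain ⟨C, h1, h2, h3⟩ := exists_systematic_convertibleCode hG he hP PI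
    (contiguousPartition (Nat.dvd_lcm_right kI kF)) (univ ×ˢ univ.image e) fun v _ => hspan _
  refine ⟨C, h1, ?_, h3⟩
  rw [h2, Finset.card_product, Finset.card_univ, Fintype.card_fin,
    Finset.card_image_of_injective _ (injective_of_submatrix_eq_one he), Finset.card_fin]
  exact Nat.div_mul_le_self _ _

/-! ### Counting: excess of overlaps and numbers of stripes -/

section Counting

/-- Only the `x i` exceeding `r` matter. If at most `q` of them do, each contributes at most `k -
r`; if more do, every one beyond the `q`-th costs another `r` from the total `q * k + t`. The bound
is affine in `S.card`, so it can be summed over classes of unknown sizes. -/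
theorem sum_tsub_le_of_class {ι : Type*} (S : Finset ι) (x : ι → ℕ) {r q t k : ℕ} (hr : r ≤ k)
    (ht : t ≤ k) (hx : ∀ i ∈ S, x i ≤ k) (hsum : ∑ i ∈ S, x i ≤ q * k + t) :
    ∑ i ∈ S, (x i - r) + q * (t - r) ≤ q * (k - r) + S.card * (t - r) := by
  classical
  let S' := S.filter fun i => r < x i
  have hS' : S' ⊆ S := Finset.filter_subset _ _
  have h1 : ∑ i ∈ S, (x i - r) = ∑ i ∈ S', (x i - r) := by
    refine (Finset.sum_subset hS' fun i hi hi' => ?_).symm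
    have : ¬ r < x i := fun h => hi' (Finset.mem_filter.2 ⟨hi, h⟩)
    omega
  have h2 : ∑ i ∈ S', (x i - r) + S'.card * r = ∑ i ∈ S', x i := by
    rw [← smul_eq_mul, ← Finset.sum_const, ← Finset.sum_add_distrib]
    refine Finset.sum_congr rfl fun i hi => ?_
    have := (Finset.mem_filter.1 hi).2
    omega
  have h3 : ∑ i ∈ S', x i ≤ q * k + t :=
    (Finset.sum_le_sum_of_subset hS').trans hsum
  have h4 : ∑ i ∈ S', (x i - r) ≤ S'.card * (k - r) := by
    rw [← smul_eq_mul]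
    refine Finset.sum_le_card_nsmul _ _ _ fun i hi => ?_
    have := hx i (hS' hi)
    omega
  have h5 := Finset.card_le_card hS'
  rw [h1]
  suffices h : ∑ i ∈ S', (x i - r) + q * (t - r) ≤ q * (k - r) + S'.card * (t - r) from
    h.trans (Nat.add_le_add_left (Nat.mul_le_mul_right _ h5) _)
  have hB : t - r ≤ k - r := by omega
  rcases le_or_gt S'.card q with hb | hb
  · obtain ⟨d, rfl⟩ := Nat.exists_eq_add_of_le hb
    have := Nat.mul_le_mul_left d hB
    rw [add_mul, add_mul]
    omega
  · obtain ⟨d, hd⟩ := Nat.exists_eq_add_of_lt hb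
    obtain ⟨A, rfl⟩ := Nat.exists_eq_add_of_le hr
    rw [hd] at h2 ⊢
    rw [Nat.add_sub_cancel_left]
    have h6 : t ≤ (t - r) + r := by omega
    have h7 : 0 ≤ d * (t - r) := Nat.zero_le _
    have h8 : 0 ≤ d * r := Nat.zero_le _
    nlinarith

/-- If `ι` is divided into classes of total size at most `q * k + t`, the total excess over `r` is
bounded. -/
theorem sum_tsub_le {ι κ : Type*} [Fintype ι] [Fintype κ] (x : ι → ℕ) (g : ι → κ)
    {r q t k s : ℕ} (hr : r ≤ k) (ht : t ≤ k) (hx : ∀ i, x i ≤ k)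
    (hsum : ∀ (S : Finset ι) (j : κ), (∀ i ∈ S, g i = j) → ∑ i ∈ S, x i ≤ q * k + t)
    (hcard : Fintype.card ι = q * Fintype.card κ + s) :
    ∑ i, (x i - r) ≤ q * Fintype.card κ * (k - r) + s * (t - r) := by
  classical
  have h : ∀ j : κ, _ := fun j => sum_tsub_le_of_class (univ.filter fun i => g i = j) x hr ht
    (fun i _ => hx i) (hsum _ j fun i hi => (Finset.mem_filter.1 hi).2)
  have h' := Finset.sum_le_sum fun j (_ : j ∈ univ) => h j
  have e0 : ∑ j, ∑ i with g i = j, (x i - r) = ∑ i, (x i - r) := Finset.sum_fiberwise _ g _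
  have e1 : ∑ j, (univ.filter fun i => g i = j).card = Fintype.card ι :=
    (Finset.card_eq_sum_card_fiberwise fun i _ => Finset.mem_coe.2 (mem_univ (g i))).symm
  rw [Finset.sum_add_distrib, Finset.sum_add_distrib, e0, Finset.sum_const, Finset.sum_const,
    ← Finset.sum_mul, e1, Finset.card_univ, hcard, smul_eq_mul, smul_eq_mul,
    add_mul, ← mul_assoc, ← mul_assoc, mul_comm _ q] at h'
  omega

theorem numStripes_mul (k k' : ℕ) : numStripes k k' * k = Nat.lcm k k' :=
  Nat.div_mul_cancel (Nat.dvd_lcm_left k k')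

theorem numStripes_mul_comm (k k' : ℕ) : numStripes k k' * k = numStripes k' k * k' := by
  rw [numStripes_mul, numStripes_mul, Nat.lcm_comm]

theorem numStripes_pos {k k' : ℕ} (hk : 0 < k) (hk' : 0 < k') : 0 < numStripes k k' :=
  Nat.div_pos (Nat.le_of_dvd (Nat.lcm_pos hk hk') (Nat.dvd_lcm_left k k')) hk

/-- The ratio of the numbers of stripes is `k' / k` as a rational number, so the integer quotients
agree. -/
theorem numStripes_eq {k k' : ℕ} (hk : 0 < k) (hk' : 0 < k') :
    numStripes k k' = k' / k * numStripes k' k + numStripes k k' % numStripes k' k := by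
  have h : numStripes k k' / numStripes k' k = k' / k := by
    rw [← Nat.mul_div_mul_right _ _ hk, numStripes_mul_comm,
      Nat.mul_div_mul_left _ _ (numStripes_pos hk' hk)]
  conv_lhs => rw [← Nat.div_add_mod (numStripes k k') (numStripes k' k), h]
  ring

/-- The residual stripes hold exactly the symbols that the stripes of size `k'` still lack after
taking `k' / k` whole stripes of size `k` each. -/
theorem numStripes_mod_mul {k k' : ℕ} (hk : 0 < k) (hk' : 0 < k') :
    numStripes k k' % numStripes k' k * k = numStripes k' k * (k' % k) := by
  have h1 := numStripes_eq hk hk'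
  have h2 := numStripes_mul_comm k k'
  have h3 := Nat.div_add_mod k' k
  generalize numStripes k k' % numStripes k' k = s at *
  generalize numStripes k k' = a at *
  generalize numStripes k' k = b at *
  generalize k' / k = q at *
  generalize k' % k = t at *
  subst h1 h3
  have : q * b * k + s * k = q * b * k + b * t := by linarith
  omega

end Counting

/-! ### Lower bounds on reading and writing -/

theorem card_le_of_linearIndepOn_of_span {F V ι : Type*} [Field F] [AddCommGroup V] [Module F V]
    {f : ι → V} {s : Finset ι} (h : LinearIndepOn F f (s : Set ι)) {B : Finset V}
    (hB : ∀ c ∈ s, f c ∈ Submodule.span F (B : Set V)) : s.card ≤ B.card := by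
  have := linearIndependent_le_span_aux' (fun c : (s : Set ι) => f c) h (B : Set V) (by
    rintro _ ⟨c, rfl⟩
    exact hB c c.2)
  simpa using this

/-- Independent vectors supported on `A` number at most `A.card`. -/
theorem card_le_of_linearIndepOn_of_support {F : Type*} [Field F] {ι : Type*} {M : ℕ}
    {f : ι → Fin M → F} {s : Finset ι} (h : LinearIndepOn F f (s : Set ι)) {A : Finset (Fin M)}
    (hA : ∀ c ∈ s, ∀ p ∉ A, f c p = 0) : s.card ≤ A.card := by
  classical
  refine (card_le_of_linearIndepOn_of_span h
    (B := A.image fun p => (Pi.single p 1 : Fin M → F)) fun c hc => ?_).trans Finset.card_image_le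
  rw [pi_eq_sum_univ' (f c)]
  refine Submodule.sum_mem _ fun p _ => ?_
  by_cases hp : p ∈ A
  · exact Submodule.smul_mem _ _ (Submodule.subset_span
      (Finset.mem_coe.2 (Finset.mem_image_of_mem _ hp)))
  · simp [hA c hc p hp]

theorem StripePartition.card_block {M k : ℕ} (P : StripePartition M k) (i : Fin (M / k)) :
    #{p | (P.index.symm p).1 = i} = k := by
  have : (univ.filter fun p => (P.index.symm p).1 = i) =
      (univ : Finset (Fin k)).image fun a => P.index (i, a) := by
    ext p
    obtain ⟨⟨j, a⟩, rfl⟩ := P.index.surjective p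
    simp [eq_comm]
  rw [this, Finset.card_image_of_injective _ fun a b h => by simpa using h, Finset.card_fin]

namespace ConvertibleCode

variable {F : Type u} [Field F] {nI kI nF kF : ℕ} (C : ConvertibleCode F nI kI nF kF)

/-- The positions read in initial stripe `i`. -/
def readIn (i : Fin (Nat.lcm kI kF / kI)) : Finset (Fin nI) :=
  univ.filter fun c => (i, c) ∈ C.readSet

/-- The positions in initial stripe `i` kept as nodes of final stripe `j`. -/
def keptFrom (i : Fin (Nat.lcm kI kF / kI)) (j : Fin (Nat.lcm kI kF / kF)) : Finset (Fin nI) :=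
  univ.filter fun c => ∃ c', C.source (j, c') = some (i, c)

/-- The positions in final stripe `j` that are unchanged nodes from initial stripe `i`. -/
def keptTo (i : Fin (Nat.lcm kI kF / kI)) (j : Fin (Nat.lcm kI kF / kF)) : Finset (Fin nF) :=
  univ.filter fun c' => ∃ c, C.source (j, c') = some (i, c)

/-- The message symbols shared by initial stripe `i` and final stripe `j`. -/
def overlap (i : Fin (Nat.lcm kI kF / kI)) (j : Fin (Nat.lcm kI kF / kF)) :
    Finset (Fin (Nat.lcm kI kF)) :=
  univ.filter fun p => (C.initialPart.index.symm p).1 = i ∧ (C.finalPart.index.symm p).1 = j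

theorem mem_readIn {i c} : c ∈ C.readIn i ↔ (i, c) ∈ C.readSet := by simp [readIn]

theorem mem_keptFrom {i j c} : c ∈ C.keptFrom i j ↔ ∃ c', C.source (j, c') = some (i, c) := by
  simp [keptFrom]

theorem mem_keptTo {i j c'} : c' ∈ C.keptTo i j ↔ ∃ c, C.source (j, c') = some (i, c) := by
  simp [keptTo]

theorem mem_overlap {i j p} : p ∈ C.overlap i j ↔
    (C.initialPart.index.symm p).1 = i ∧ (C.finalPart.index.symm p).1 = j := by
  simp [overlap]

theorem sum_card_readIn : ∑ i, (C.readIn i).card = C.readSet.card := by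
  classical
  rw [Finset.card_eq_sum_card_fiberwise (f := Prod.fst) (t := univ) fun i _ =>
    Finset.mem_coe.2 (mem_univ _)]
  refine Finset.sum_congr rfl fun i _ => ?_
  have : C.readSet.filter (fun w => w.1 = i) = (C.readIn i).image (Prod.mk i) := by
    ext ⟨i', c⟩
    simp only [mem_filter, mem_image, mem_readIn, Prod.mk.injEq]
    constructor
    · rintro ⟨h, rfl⟩
      exact ⟨c, h, rfl, rfl⟩
    · rintro ⟨c, h, rfl, rfl⟩
      exact ⟨h, rfl⟩
  rw [this, Finset.card_image_of_injective _ (Prod.mk_right_injective _)]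

theorem card_overlap_le_left (i j) : (C.overlap i j).card ≤ kI := by
  refine (Finset.card_le_card fun p hp => ?_).trans_eq (C.initialPart.card_block i)
  exact Finset.mem_filter.2 ⟨mem_univ _, (C.mem_overlap.1 hp).1⟩

theorem card_overlap_le_right (i j) : (C.overlap i j).card ≤ kF := by
  refine (Finset.card_le_card fun p hp => ?_).trans_eq (C.finalPart.card_block j)
  exact Finset.mem_filter.2 ⟨mem_univ _, (C.mem_overlap.1 hp).2⟩

theorem sum_card_overlap_le (S : Finset (Fin (Nat.lcm kI kF / kI))) (j) :
    ∑ i ∈ S, (C.overlap i j).card ≤ kF := by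
  classical
  rw [← Finset.card_biUnion]
  · refine (Finset.card_le_card fun p hp => ?_).trans_eq (C.finalPart.card_block j)
    obtain ⟨i, -, hp⟩ := Finset.mem_biUnion.1 hp
    exact Finset.mem_filter.2 ⟨mem_univ _, (C.mem_overlap.1 hp).2⟩
  · intro i _ i' _ hne
    rw [Function.onFun, Finset.disjoint_left]
    intro p hp hp'
    exact hne ((C.mem_overlap.1 hp).1.symm.trans (C.mem_overlap.1 hp').1)

theorem card_keptFrom (i j) : (C.keptFrom i j).card = (C.keptTo i j).card := by
  apply le_antisymm
  · refine Finset.card_le_card_of_forall_subsingleton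
      (fun c c' => C.source (j, c') = some (i, c)) (fun c hc => ?_) fun c' _ c₁ h₁ c₂ h₂ => ?_
    · obtain ⟨c', h⟩ := C.mem_keptFrom.1 hc
      exact ⟨c', C.mem_keptTo.2 ⟨c, h⟩, h⟩
    · have := h₁.2.symm.trans h₂.2
      simpa using this
  · refine Finset.card_le_card_of_forall_subsingleton
      (fun c' c => C.source (j, c') = some (i, c)) (fun c' hc => ?_) fun c _ c₁ h₁ c₂ h₂ => ?_
    · obtain ⟨c, h⟩ := C.mem_keptTo.1 hc
      exact ⟨c, C.mem_keptFrom.2 ⟨c', h⟩, h⟩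
    · have := C.source_inj _ _ _ h₁.2 h₂.2
      simpa using this

theorem vec_apply_eq_zero {i c j c'} (h : C.source (j, c') = some (i, c)) {p}
    (hp : p ∉ C.overlap i j) : C.initialPart.vec C.initialGen (i, c) p = 0 := by
  rw [mem_overlap, not_and_or] at hp
  rcases hp with hp | hp
  · simp [StripePartition.vec, StripePartition.extend_apply, hp]
  · rw [← C.vec_eq_of_source h]
    simp [StripePartition.vec, StripePartition.extend_apply, hp]

/-- Between codes of different dimension, two stripes share at most as many nodes as message
symbols. -/
theorem card_keptTo_le (hne : kI ≠ kF) (i j) :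
    (C.keptTo i j).card ≤ (C.overlap i j).card := by
  by_contra! hlt
  have hl := C.card_overlap_le_left i j
  have hr := C.card_overlap_le_right i j
  -- The overlap is at most `min kI kF`, so one node more is still at most the larger dimension.
  -- That many nodes are independent in the corresponding stripe, yet supported on too few
  -- coordinates.
  rcases lt_or_gt_of_ne hne with h | h
  · obtain ⟨t, ht, htc⟩ := Finset.exists_subset_card_eq (Nat.succ_le_of_lt hlt)
    have := card_le_of_linearIndepOn_of_support
      (C.finalPart.linearIndepOn_vec C.final_mds j (s := t) (by omega))
      (A := C.overlap i j) fun c' hc' p hp => by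
        obtain ⟨c, hc⟩ := C.mem_keptTo.1 (ht hc')
        rw [C.vec_eq_of_source hc, C.vec_apply_eq_zero hc hp]
    omega
  · rw [← card_keptFrom] at hlt
    obtain ⟨t, ht, htc⟩ := Finset.exists_subset_card_eq (Nat.succ_le_of_lt hlt)
    have := card_le_of_linearIndepOn_of_support
      (C.initialPart.linearIndepOn_vec C.initial_mds i (s := t) (by omega))
      (A := C.overlap i j) fun c hc p hp => by
        obtain ⟨c', hc'⟩ := C.mem_keptFrom.1 (ht hc)
        rw [C.vec_apply_eq_zero hc' hp]
    omega

/-- Restricted to an initial stripe, a new node is a combination of the nodes read there. -/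
theorem restrict_vec_mem_span {v} (hv : C.source v = none) (i) :
    C.initialPart.restrict F i (C.finalPart.vec C.finalGen v) ∈ Submodule.span F
      (C.initialGen.col '' (C.readIn i : Set (Fin nI))) := by
  rw [C.vec_eq_of_source_none hv, map_sum]
  refine Submodule.sum_mem _ fun w hw => ?_
  rw [map_smul]
  refine Submodule.smul_mem _ _ ?_
  obtain ⟨i', c⟩ := w
  by_cases hi : i' = i
  · subst hi
    rw [StripePartition.vec, StripePartition.restrict_extend_self]
    exact Submodule.subset_span ⟨c, by simp [mem_readIn, hw], rfl⟩
  · rw [StripePartition.vec, StripePartition.restrict_extend_of_ne _ (Ne.symm hi)]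
    exact Submodule.zero_mem _

/-- Final stripe `j` can be decoded without the unchanged nodes in `T`. -/
theorem restrict_extend_mem_span {i j} {T : Finset (Fin nI)} (hT : T.card ≤ nF - kF)
    (y : Fin kF → F) :
    C.initialPart.restrict F i (C.finalPart.extend F j y) ∈ Submodule.span F
      (C.initialGen.col '' (C.readIn i ∪ (C.keptFrom i j \ T) : Finset (Fin nI))) := by
  classical
  -- Erasing the final positions that come from `T` leaves at least `kF` symbols, which still span.
  let B : Finset (Fin nF) := univ.filter fun c' => ∃ c ∈ T, C.source (j, c') = some (i, c)
  have hB : B.card ≤ T.card := by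
    refine Finset.card_le_card_of_forall_subsingleton
      (fun c' c => C.source (j, c') = some (i, c)) (fun c' hc => (Finset.mem_filter.1 hc).2)
      fun c _ c₁ h₁ c₂ h₂ => ?_
    have := C.source_inj _ _ _ h₁.2 h₂.2
    simpa using this
  have htop := C.final_mds.span_col_eq_top (s := Bᶜ) (by
    have := C.final_mds.1
    rw [Finset.card_compl, Fintype.card_fin]
    omega)
  have hy : y ∈ Submodule.span F (C.finalGen.col '' ((Bᶜ : Finset (Fin nF)) : Set (Fin nF))) := by
    rw [htop]; trivial
  have hmem := Submodule.mem_map_of_mem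
    (f := (C.initialPart.restrict F i).comp (C.finalPart.extend F j)) hy
  rw [Submodule.map_span, LinearMap.comp_apply] at hmem
  refine Submodule.span_le.2 ?_ hmem
  rintro _ ⟨_, ⟨c', hc', rfl⟩, rfl⟩
  change C.initialPart.restrict F i (C.finalPart.vec C.finalGen (j, c')) ∈ _
  rcases hs : C.source (j, c') with _ | ⟨i', c⟩
  · exact Submodule.span_mono (Set.image_mono (Finset.coe_subset.2 Finset.subset_union_left))
      (C.restrict_vec_mem_span hs i)
  · rw [C.vec_eq_of_source hs]
    by_cases hi : i' = i
    · subst hi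
      rw [StripePartition.vec, StripePartition.restrict_extend_self]
      refine Submodule.subset_span ⟨c, ?_, rfl⟩
      have h1 : c ∈ C.keptFrom i' j := C.mem_keptFrom.2 ⟨c', hs⟩
      have h2 : c ∉ T := fun h => Finset.mem_compl.1 hc' (Finset.mem_filter.2
        ⟨mem_univ _, c, h, hs⟩)
      simp [h1, h2]
    · rw [StripePartition.vec, StripePartition.restrict_extend_of_ne _ (Ne.symm hi)]
      exact Submodule.zero_mem _

/-- The number of nodes read from a single initial stripe. -/
theorem exists_le_card_readIn (hne : kI ≠ kF) (hkI : 0 < kI) (hkF : 0 < kF) (hnF : kF < nF) (i) :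
    ∃ j, kI ≤ (C.readIn i).card + ((C.overlap i j).card - (nF - kF)) ∧
      (nI - kI < nF - kF → kI ≤ (C.readIn i).card) := by
  classical
  -- If every kept node is also read, the nodes read in stripe `i` determine all of its symbols, and
  -- any `j` serves.
  by_cases hall : ∀ j, C.keptFrom i j ⊆ C.readIn i
  · have h : kI ≤ (C.readIn i).card := by
      apply le_card_of_span_col_eq_top (G := C.initialGen)
      rw [eq_top_iff]
      rintro x -
      have hx := C.finalPart.sum_extend_restrict (C.initialPart.extend F i x)
      rw [← C.initialPart.restrict_extend_self i x, ← hx, map_sum]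
      refine Submodule.sum_mem _ fun j _ => ?_
      have := C.restrict_extend_mem_span (i := i) (j := j) (T := ∅) (Nat.zero_le _)
        (C.finalPart.restrict F j (C.initialPart.extend F i x))
      rwa [Finset.sdiff_empty, Finset.union_eq_left.2 (hall j)] at this
    exact ⟨⟨0, numStripes_pos hkF hkI |>.trans_eq (by rw [numStripes, Nat.lcm_comm])⟩,
      h.trans (Nat.le_add_right _ _), fun _ => h⟩
  · push Not at hall
    obtain ⟨j, hj⟩ := hall
    have hT0 : 0 < (C.keptFrom i j \ C.readIn i).card :=
      Finset.card_pos.2 (Finset.sdiff_nonempty.2 hj)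
    -- As many unread kept nodes as decoding tolerates are left out. A node of `T` then lies in the
    -- span of `S` without belonging to it, which in an MDS code forces `kI ≤ S.card`.
    obtain ⟨T, hT, hTc⟩ := Finset.exists_subset_card_eq
      (min_le_right (nF - kF) (C.keptFrom i j \ C.readIn i).card)
    obtain ⟨c, hc⟩ : T.Nonempty := Finset.card_pos.1 (by omega)
    set S := C.readIn i ∪ (C.keptFrom i j \ T) with hS
    have hcS : c ∉ S := by
      have := Finset.mem_sdiff.1 (hT hc)
      simp [hS, this.2, hc]
    have hcspan : C.initialGen.col c ∈ Submodule.span F (C.initialGen.col '' (S : Set _)) := by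
      obtain ⟨c', hc'⟩ := C.mem_keptFrom.1 (Finset.mem_sdiff.1 (hT hc)).1
      have := C.restrict_extend_mem_span (i := i) (j := j) (T := T) (by omega)
        (C.finalGen.col c')
      have h2 := C.vec_eq_of_source hc'
      rw [StripePartition.vec, StripePartition.vec] at h2
      rwa [h2, StripePartition.restrict_extend_self] at this
    have hSc : kI ≤ S.card := by
      by_contra! hlt
      have hind := C.initial_mds.linearIndepOn (s := insert c S)
        ((Finset.card_insert_le _ _).trans hlt)
      rw [Finset.coe_insert, linearIndepOn_insert (by simpa using hcS)] at hind
      exact hind.2 hcspan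
    have hle := C.card_keptTo_le hne i j
    rw [← card_keptFrom] at hle
    have hS' : S = C.readIn i ∪ ((C.keptFrom i j \ C.readIn i) \ T) := by
      ext x
      simp only [hS, mem_union, mem_sdiff]
      tauto
    have hcard : S.card ≤ (C.readIn i).card + ((C.keptFrom i j \ C.readIn i).card - T.card) := by
      rw [hS', ← Finset.card_sdiff_of_subset hT]
      exact Finset.card_union_le _ _
    have h3 := Finset.card_le_card (Finset.sdiff_subset (s := C.keptFrom i j) (t := C.readIn i))
    refine ⟨j, by omega, fun hr => ?_⟩
    -- Since `S` has at least `kI` of the `nI` positions, `T` has at most `nI - kI`. When this is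
    -- below `nF - kF`, `T` exhausts the unread kept nodes, so `S` consists of nodes read.
    have hS2 : S.card + T.card ≤ nI := by
      rw [← Finset.card_union_of_disjoint]
      · exact (Finset.card_le_univ _).trans_eq (Fintype.card_fin _)
      · rw [Finset.disjoint_right]
        intro x hx
        have := Finset.mem_sdiff.1 (hT hx)
        simp [hS, this.2, hx]
    have := C.initial_mds.1
    omega

/-- In the first regime each stripe needs `kI` reads, since the excess vanishes or `nI - kI < nF -
kF`. In the second, stripes are grouped by the final stripe `g i` supplied by the per-stripe bound,
and the total excess is subtracted from `M`. -/
theorem readBound_le (hne : kI ≠ kF) (hkI : 0 < kI) (hkF : 0 < kF) (hnF : kF < nF) :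
    readBound nI kI nF kF ≤ C.readSet.card := by
  choose g hg hg' using C.exists_le_card_readIn hne hkI hkF hnF
  have hM := numStripes_mul kI kF
  have hsum : ∑ i : Fin (Nat.lcm kI kF / kI), kI = Nat.lcm kI kF := by
    rw [Finset.sum_const, Finset.card_univ, Fintype.card_fin, smul_eq_mul]
    exact hM
  rw [← sum_card_readIn, readBound]
  split_ifs with h
  · refine hsum.ge.trans (Finset.sum_le_sum fun i _ => ?_)
    rcases h with h | h
    · exact hg' i h
    · have h1 := hg i
      have h2 := C.card_overlap_le_left i (g i)
      have h3 := C.card_overlap_le_right i (g i)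
      omega
  · push Not at h
    have h1 := Finset.sum_le_sum fun i (_ : i ∈ univ) => hg i
    rw [hsum, Finset.sum_add_distrib] at h1
    have hmod := Nat.mod_lt kF hkI
    have hcard := numStripes_eq hkI hkF
    have h2 := sum_tsub_le (fun i => (C.overlap i (g i)).card) g (r := nF - kF) (q := kF / kI)
      (t := kF % kI) (k := kI) (s := numStripes kI kF % numStripes kF kI) (by omega) hmod.le
      (fun i => C.card_overlap_le_left i (g i)) (fun S j hS => by
        rw [Nat.div_add_mod']
        refine (Finset.sum_congr rfl fun i hi => ?_).trans_le (C.sum_card_overlap_le S j)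
        rw [hS i hi]) (by
        rw [Fintype.card_fin, Fintype.card_fin]
        rw [numStripes, numStripes, Nat.lcm_comm kF kI] at hcard
        rw [numStripes, numStripes, Nat.lcm_comm kF kI]
        exact hcard)
    rw [Fintype.card_fin] at h2
    have e : Nat.lcm kI kF / kF = numStripes kF kI := by rw [numStripes, Nat.lcm_comm]
    rw [e] at h2
    generalize ∑ i, (C.readIn i).card = R at *
    generalize ∑ i, ((C.overlap i (g i)).card - (nF - kF)) = E at *
    generalize numStripes kI kF % numStripes kF kI = s at *
    generalize numStripes kF kI = b at *
    generalize kF / kI * b = qb at *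
    rw [hcard] at hM ⊢
    generalize nF - kF = r at *
    generalize kF % kI = t at *
    obtain ⟨A, hA⟩ := Nat.exists_eq_add_of_lt h.2
    have hrk : r ≤ kI := by omega
    obtain ⟨d, rfl⟩ := Nat.exists_eq_add_of_le hrk
    rw [Nat.add_sub_cancel_left] at h2
    have e2 : s * d = s * (t - r) + s * (r + d - max t r) := by
      rw [← mul_add]
      congr 1
      omega
    rw [← hM] at h1
    have e3 : (qb + s) * (r + d) = (qb + s) * r + qb * d + s * d := by ring
    omega

theorem card_newNodes (j : Fin (Nat.lcm kI kF / kF)) :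
    #{c' | (C.source (j, c')).isNone} + ∑ i, (C.keptTo i j).card = nF := by
  classical
  rw [← Finset.card_biUnion]
  · rw [← Finset.card_union_of_disjoint]
    · conv_rhs => rw [← Fintype.card_fin nF, ← Finset.card_univ]
      congr 1
      ext c'
      rcases hs : C.source (j, c') with _ | ⟨i, c⟩ <;> simp [hs, mem_keptTo]
    · rw [Finset.disjoint_left]
      intro c' h h'
      obtain ⟨i, -, hi⟩ := Finset.mem_biUnion.1 h'
      obtain ⟨c, hc⟩ := C.mem_keptTo.1 hi
      simp [hc] at h
  · intro i _ i' _ hne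
    rw [Function.onFun, Finset.disjoint_left]
    intro c' h h'
    obtain ⟨c, hc⟩ := C.mem_keptTo.1 h
    obtain ⟨c₂, hc₂⟩ := C.mem_keptTo.1 h'
    have := hc.symm.trans hc₂
    simp only [Option.some.injEq, Prod.mk.injEq] at this
    exact hne this.1

theorem sum_card_newNodes :
    ∑ j, #{c' | (C.source (j, c')).isNone} = C.newNodes.card := by
  classical
  rw [Finset.card_eq_sum_card_fiberwise (f := Prod.fst) (t := univ) fun i _ =>
    Finset.mem_coe.2 (mem_univ _)]
  refine Finset.sum_congr rfl fun j _ => ?_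
  have : C.newNodes.filter (fun w => w.1 = j) =
      (univ.filter fun c' => (C.source (j, c')).isNone = true).image (Prod.mk j) := by
    ext ⟨j', c⟩
    simp only [mem_filter, mem_image, newNodes, Prod.mk.injEq, mem_univ, true_and]
    constructor
    · rintro ⟨h, rfl⟩
      exact ⟨c, h, rfl, rfl⟩
    · rintro ⟨c, h, rfl, rfl⟩
      exact ⟨h, rfl⟩
  rw [this, Finset.card_image_of_injective _ (Prod.mk_right_injective _)]

/-- The nodes kept in a final stripe are bounded by its overlaps, which sum to at most `kF`. -/
theorem writeBound_le (hne : kI ≠ kF) : writeBound kI nF kF ≤ C.newNodes.card := by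
  rw [← sum_card_newNodes, writeBound, numStripes, Nat.lcm_comm, ← smul_eq_mul]
  conv_lhs => rw [← Fintype.card_fin (Nat.lcm kI kF / kF), ← Finset.card_univ]
  refine Finset.card_nsmul_le_sum _ _ _ fun j _ => ?_
  have h1 := C.card_newNodes j
  have h2 := (Finset.sum_le_sum fun i (_ : i ∈ univ) => C.card_keptTo_le hne i j).trans
    (C.sum_card_overlap_le univ j)
  omega

end ConvertibleCode

/-- The cost of lengthening a code without changing its dimension. -/
theorem ConvertibleCode.add_le_accessCost {F : Type u} [Field F] {nI nF k : ℕ}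
    (C : ConvertibleCode F nI k nF k) (hk : 0 < k) (hn : nI < nF) :
    k + (nF - nI) ≤ C.accessCost := by
  classical
  have h1 : Nat.lcm k k / k = 1 := by rw [Nat.lcm_self, Nat.div_self hk]
  let j : Fin (Nat.lcm k k / k) := ⟨0, by omega⟩
  -- All nodes in `X` lie in the span of the nodes read. With fewer than `k` reads, independence
  -- gives `X.card ≤ C.readSet.card`; the other final nodes are unread initial nodes, so `nF ≤ nI`,
  -- a contradiction.
  let X : Finset (Fin nF) := univ.filter fun c' =>
    C.source (j, c') = none ∨ ∃ w ∈ C.readSet, C.source (j, c') = some w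
  have hcount : ∀ (A : Finset (Fin nF)) (D : Finset (Fin (Nat.lcm k k / k) × Fin nI)),
      (∀ c' ∈ A, ∃ w ∈ D, C.source (j, c') = some w) → A.card ≤ D.card := by
    intro A D h
    refine Finset.card_le_card_of_forall_subsingleton
      (fun c' w => C.source (j, c') = some w) h fun w _ c₁ h₁ c₂ h₂ => ?_
    have := C.source_inj _ _ _ h₁.2 h₂.2
    simpa using this
  have hnodes : Fintype.card (Fin (Nat.lcm k k / k) × Fin nI) = nI := by
    rw [Fintype.card_prod, Fintype.card_fin, Fintype.card_fin, h1, one_mul]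
  have hXc : Xᶜ.card ≤ nI - C.readSet.card := by
    have hcompl := Finset.card_compl C.readSet
    rw [hnodes] at hcompl
    refine (hcount _ C.readSetᶜ fun c' hc' => ?_).trans_eq hcompl
    simp only [X, mem_compl, mem_filter, mem_univ, true_and, not_or, not_exists, not_and] at hc'
    obtain ⟨w, hw⟩ := Option.ne_none_iff_exists'.1 hc'.1
    exact ⟨w, Finset.mem_compl.2 fun hwr => hc'.2 w hwr hw, hw⟩
  have hread : k ≤ C.readSet.card := by
    by_contra! hlt
    have hX : X.card ≤ C.readSet.card := by
      by_contra! hXlt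
      obtain ⟨t, ht, htc⟩ := Finset.exists_subset_card_eq (Nat.succ_le_of_lt hXlt)
      have := (card_le_of_linearIndepOn_of_span
        (C.finalPart.linearIndepOn_vec C.final_mds j (s := t) (by omega))
        (B := C.readSet.image (C.initialPart.vec C.initialGen)) fun c' hc' => by
          rw [Finset.coe_image]
          rcases (Finset.mem_filter.1 (ht hc')).2 with h | ⟨w, hw, h⟩
          · rw [C.vec_eq_of_source_none h]
            exact Submodule.sum_mem _ fun w hw => Submodule.smul_mem _ _
              (Submodule.subset_span ⟨w, hw, rfl⟩)
          · rw [C.vec_eq_of_source h]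
            exact Submodule.subset_span ⟨w, hw, rfl⟩).trans Finset.card_image_le
      omega
    have h2 := Finset.card_add_card_compl X
    have h3 : C.readSet.card ≤ nI := (Finset.card_le_univ _).trans_eq hnodes
    rw [Fintype.card_fin] at h2
    omega
  have hnew : nF ≤ C.newNodes.card + nI := by
    let Y : Finset (Fin nF) := univ.filter fun c' => (C.source (j, c')).isNone
    have hY : Y.card ≤ C.newNodes.card := by
      refine Finset.card_le_card_of_injOn (Prod.mk j) (fun c' hc' => ?_) fun a _ b _ h => by
        simpa using h
      exact Finset.mem_coe.2 (Finset.mem_filter.2 ⟨mem_univ _, (Finset.mem_filter.1 hc').2⟩)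
    have hYc : Yᶜ.card ≤ nI := by
      refine (hcount _ univ fun c' hc' => ?_).trans_eq (Finset.card_univ.trans hnodes)
      simp only [Y, mem_compl, mem_filter, mem_univ, true_and, Option.isNone_iff_eq_none] at hc'
      obtain ⟨w, hw⟩ := Option.ne_none_iff_exists'.1 hc'
      exact ⟨w, mem_univ _, hw⟩
    have h2 := Finset.card_add_card_compl Y
    rw [Fintype.card_fin] at h2
    omega
  rw [accessCost]
  omega

/-! ### The initial partition: merged and residual stripes -/

section SplitPartition

/-- The final stripe of the message symbol at position `a` of initial stripe `i`. Of the initial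
stripes, `q * b` are merged in groups of `q`; each remaining stripe gives `t` symbols to one final
stripe and distributes the others. -/
def splitStripe (kI q b s t i a : ℕ) : ℕ :=
  if i < q * b then i / q else if a < t then i - q * b
  else s + ((i - q * b) * (kI - t) + (a - t)) / t

/-- The position in its final stripe of the message symbol at position `a` of initial stripe `i`. -/
def splitPos (kI q b t i a : ℕ) : ℕ :=
  if i < q * b then i % q * kI + a else if a < t then q * kI + a
  else q * kI + ((i - q * b) * (kI - t) + (a - t)) % t

theorem mul_add_inj {x x' k a a' : ℕ} (ha : a < k) (ha' : a' < k) (h : x * k + a = x' * k + a') :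
    x = x' ∧ a = a' := by
  have h1 : (x * k + a) / k = x := by
    rw [mul_comm, Nat.mul_add_div (by omega), Nat.div_eq_of_lt ha, add_zero]
  have h2 : (x' * k + a') / k = x' := by
    rw [mul_comm, Nat.mul_add_div (by omega), Nat.div_eq_of_lt ha', add_zero]
  have h3 : x = x' := by rw [← h1, h, h2]
  subst h3
  exact ⟨rfl, by omega⟩

theorem mul_add_lt {x x' k a a' : ℕ} (ha : a < k) (h : x < x' ∨ x = x' ∧ a < a') :
    x * k + a < x' * k + a' := by
  rcases h with h | ⟨rfl, h⟩
  · have := Nat.mul_le_mul_right k (Nat.succ_le_of_lt h)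
    rw [Nat.succ_mul] at this
    omega
  · omega

variable {kI q b s t i a i' a' : ℕ}

theorem pos_of_residual (hs : s * kI = b * t) (hi : i < q * b + s) (hi' : ¬ i < q * b)
    (ha : a < kI) : 0 < t := by
  have : 0 < s * kI := Nat.mul_pos (by omega) (by omega)
  rw [hs] at this
  exact Nat.pos_of_mul_pos_left this

theorem splitPos_lt (hs : s * kI = b * t) (hi : i < q * b + s) (ha : a < kI) :
    splitPos kI q b t i a < q * kI + t := by
  unfold splitPos
  split_ifs with h1 h2
  · have hq : 0 < q := Nat.pos_of_ne_zero fun h => by simp [h] at h1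
    have := Nat.mul_le_mul_right kI (Nat.succ_le_of_lt (Nat.mod_lt i hq))
    rw [Nat.succ_mul] at this
    omega
  · omega
  · have := Nat.mod_lt ((i - q * b) * (kI - t) + (a - t)) (pos_of_residual hs hi h1 ha)
    omega

theorem splitPos_lt_of_lt (hi : i < q * b) (ha : a < kI) : splitPos kI q b t i a < q * kI := by
  have hq : 0 < q := Nat.pos_of_ne_zero fun h => by simp [h] at hi
  have := Nat.mul_le_mul_right kI (Nat.succ_le_of_lt (Nat.mod_lt i hq))
  rw [Nat.succ_mul] at this
  rw [splitPos, if_pos hi]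
  omega

theorem le_splitPos_of_le (hi : ¬ i < q * b) : q * kI ≤ splitPos kI q b t i a := by
  rw [splitPos, if_neg hi]
  split_ifs <;> omega

/-- The scattered symbols of the residual stripes number `s * (kI - t) = (b - s) * t`. Laid end to
end and cut into pieces of length `t`, they exactly serve the final stripes from `s` on. -/
theorem splitStripe_lt (hs : s * kI = b * t) (hsb : s ≤ b) (htk : t < kI) (hi : i < q * b + s)
    (ha : a < kI) : splitStripe kI q b s t i a < b := by
  unfold splitStripe
  split_ifs with h1 h2
  · exact Nat.div_lt_of_lt_mul h1
  · omega
  · have h3 : i - q * b + 1 ≤ s := by omega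
    have h4 := Nat.mul_le_mul_right (kI - t) h3
    obtain ⟨d, rfl⟩ := Nat.exists_eq_add_of_le hsb
    obtain ⟨k, rfl⟩ := Nat.exists_eq_add_of_lt htk
    have h5 : s * (t + k + 1 - t) = t * d := by
      have : t + k + 1 - t = k + 1 := by omega
      rw [this]
      nlinarith
    have : ((i - q * (s + d)) * (t + k + 1 - t) + (a - t)) / t < d := by
      apply Nat.div_lt_of_lt_mul
      rw [← h5]
      refine lt_of_lt_of_le ?_ h4
      rw [Nat.add_one_mul]
      omega
    omega

theorem split_injective (htk : t < kI)
    (hi : i < q * b + s) (ha : a < kI) (hi' : i' < q * b + s) (ha' : a' < kI)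
    (hS : splitStripe kI q b s t i a = splitStripe kI q b s t i' a')
    (hP : splitPos kI q b t i a = splitPos kI q b t i' a') : i = i' ∧ a = a' := by
  by_cases h1 : i < q * b <;> by_cases h1' : i' < q * b
  · simp only [splitStripe, splitPos, if_pos h1, if_pos h1'] at hS hP
    obtain ⟨hm, rfl⟩ := mul_add_inj ha ha' hP
    refine ⟨?_, rfl⟩
    rw [← Nat.div_add_mod i q, ← Nat.div_add_mod i' q, hS, hm]
  · have := splitPos_lt_of_lt (t := t) h1 ha
    have := le_splitPos_of_le (kI := kI) (t := t) (a := a') h1'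
    omega
  · have := splitPos_lt_of_lt (t := t) h1' ha'
    have := le_splitPos_of_le (kI := kI) (t := t) (a := a) h1
    omega
  · simp only [splitStripe, splitPos, if_neg h1, if_neg h1'] at hS hP
    by_cases h2 : a < t <;> by_cases h2' : a' < t
    · simp only [if_pos h2, if_pos h2'] at hS hP
      omega
    · simp only [if_pos h2, if_neg h2'] at hS
      generalize ((i' - q * b) * (kI - t) + (a' - t)) / t = z at hS
      omega
    · simp only [if_neg h2, if_pos h2'] at hS
      generalize ((i - q * b) * (kI - t) + (a - t)) / t = z at hS
      omega
    · simp only [if_neg h2, if_neg h2'] at hS hP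
      have hy : (i - q * b) * (kI - t) + (a - t) = (i' - q * b) * (kI - t) + (a' - t) := by
        rw [← Nat.div_add_mod ((i - q * b) * (kI - t) + (a - t)) t,
          ← Nat.div_add_mod ((i' - q * b) * (kI - t) + (a' - t)) t, Nat.add_left_cancel hS,
          Nat.add_left_cancel hP]
      have := mul_add_inj (by omega) (by omega) hy
      omega

/-- Blocks of a partition must be enumerated increasingly; for the contiguous final partition this
is lexicographic order of stripe and position. -/
theorem split_lex (hi : i < q * b + s) (h : a < a') :
    splitStripe kI q b s t i a < splitStripe kI q b s t i a' ∨
      splitStripe kI q b s t i a = splitStripe kI q b s t i a' ∧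
        splitPos kI q b t i a < splitPos kI q b t i a' := by
  by_cases h1 : i < q * b
  · simp [splitStripe, splitPos, h1, h]
  · simp only [splitStripe, splitPos, if_neg h1]
    by_cases h2 : a < t <;> by_cases h2' : a' < t
    · simp [h2, h2', h]
    · left
      simp only [if_pos h2, if_neg h2']
      generalize ((i - q * b) * (kI - t) + (a' - t)) / t = z
      omega
    · omega
    · simp only [if_neg h2, if_neg h2']
      have hy : (i - q * b) * (kI - t) + (a - t) < (i - q * b) * (kI - t) + (a' - t) := by omega
      generalize (i - q * b) * (kI - t) + (a - t) = y at *
      generalize (i - q * b) * (kI - t) + (a' - t) = y' at *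
      rcases (Nat.div_le_div_right (c := t) hy.le).lt_or_eq with h3 | h3
      · left; omega
      · right
        refine ⟨by omega, ?_⟩
        have e1 := Nat.div_add_mod y t
        have e2 := Nat.div_add_mod y' t
        rw [h3] at e1
        omega

/-- There is an initial partition adapted to the contiguous final partition. -/
theorem exists_splitPartition {M kF : ℕ} (hs : s * kI = b * t) (hsb : s ≤ b) (htk : t < kI)
    (hkF : kF = q * kI + t) (hMI : M / kI = q * b + s) (hM : M = b * kF) (hF : kF ∣ M)
    (hI : kI ∣ M) :
    ∃ PI : StripePartition M kI, ∀ (i : Fin (M / kI)) (a : Fin kI),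
      ∃ (h : splitStripe kI q b s t i a < M / kF) (h' : splitPos kI q b t i a < kF),
        PI.index (i, a) = (contiguousPartition hF).index (⟨_, h⟩, ⟨_, h'⟩) := by
  have hpos : ∀ (i : Fin (M / kI)) (a : Fin kI), splitPos kI q b t i a < kF := fun i a => by
    rw [hkF]
    exact splitPos_lt hs (i.2.trans_eq hMI) a.2
  have hstr : ∀ (i : Fin (M / kI)) (a : Fin kI), splitStripe kI q b s t i a < M / kF := fun i a => by
    have h := splitStripe_lt hs hsb htk (i.2.trans_eq hMI) a.2
    have h0 : 0 < kF := by have := hpos i a; omega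
    have hb : M / kF = b := by rw [hM, Nat.mul_div_cancel _ h0]
    exact h.trans_eq hb.symm
  let f : Fin (M / kI) × Fin kI → Fin M := fun w =>
    (contiguousPartition hF).index (⟨_, hstr w.1 w.2⟩, ⟨_, hpos w.1 w.2⟩)
  have hf : Function.Injective f := by
    rintro ⟨i, a⟩ ⟨i', a'⟩ h
    have := (contiguousPartition hF).index.injective h
    simp only [Prod.mk.injEq, Fin.mk.injEq] at this
    have := split_injective htk (i.2.trans_eq hMI) a.2 (i'.2.trans_eq hMI) a'.2 this.1 this.2
    exact Prod.ext (Fin.ext this.1) (Fin.ext this.2)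
  have hbij : Function.Bijective f := by
    rw [Fintype.bijective_iff_injective_and_card]
    refine ⟨hf, ?_⟩
    rw [Fintype.card_prod, Fintype.card_fin, Fintype.card_fin, Fintype.card_fin,
      Nat.div_mul_cancel hI]
  refine ⟨⟨Equiv.ofBijective f hbij, fun i a a' h => ?_⟩, fun i a => ⟨hstr i a, hpos i a, rfl⟩⟩
  rw [Fin.lt_def]
  simp only [Equiv.ofBijective_apply, f, contiguousPartition_index]
  exact mul_add_lt (hpos i a) (split_lex (i.2.trans_eq hMI) h)

end SplitPartition

/-! ### Conversion by merging -/

/-- Any vector vanishing before `t` is generated by the systematic nodes from `t` on. -/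
theorem mem_span_systematic {F : Type u} [Field F] {k n t : ℕ} {G : Matrix (Fin k) (Fin n) F}
    {e : Fin k → Fin n} (he : G.submatrix id e = 1) {x : Fin k → F} (hx : ∀ a, a.1 < t → x a = 0)
    {D : Finset (Fin n)} (hD : ∀ a : Fin k, t ≤ a.1 → e a ∈ D) :
    x ∈ Submodule.span F (G.col '' (D : Set (Fin n))) := by
  rw [pi_eq_sum_univ' x]
  refine Submodule.sum_mem _ fun a _ => ?_
  rcases lt_or_ge a.1 t with h | h
  · simp [hx a h]
  · refine Submodule.smul_mem _ _ (Submodule.subset_span ⟨e a, hD a h, ?_⟩)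
    rw [col_of_submatrix_eq_one he]

/-- Conversion by merging, for the general parameters: `P` consists of `ς` blocks of `kI` rows,
whose columns are combinations of at most `nF - kF` columns of `G`. -/
theorem exists_convertibleCode_of_merge {F : Type u} [Field F] {nI kI nF kF ς : ℕ}
    {G : Matrix (Fin kI) (Fin nI) F} (hG : IsMDS G) {e : Fin kI → Fin nI}
    (he : G.submatrix id e = 1) {P : ℕ → ℕ → F}
    (hP : IsMDS (stdGen P (ς * kI) (ς * kI + (nF - kF)))) {Dr : ℕ → Finset (Fin nI)}
    (hDr : ∀ l < ς, (Dr l).card ≤ nF - kF)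
    (hspan : ∀ l < ς, ∀ v < nF - kF, (fun a : Fin kI => P (l * kI + a) v) ∈
      Submodule.span F (G.col '' (Dr l : Set (Fin nI))))
    (hkI : 0 < kI) (hkF : 0 < kF) (hk : kF ≤ ς * kI) (hn : kF < nF) (hr : nF - kF < kI) :
    ∃ C : ConvertibleCode F nI kI nF kF, C.initialGen = G ∧
      C.readSet.card ≤ numStripes kI kF * (nF - kF) +
        (numStripes kI kF % numStripes kF kI) * (kI - max (kF % kI) (nF - kF)) ∧
      C.newNodes.card = numStripes kF kI * (nF - kF) := by
  classical
  have hbpos := numStripes_pos hkF hkI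
  have hs := numStripes_mod_mul hkI hkF
  have hsb := Nat.mod_lt (numStripes kI kF) hbpos
  have hMI := numStripes_eq hkI hkF
  have hM := numStripes_mul kF kI
  have htk := Nat.mod_lt kF hkI
  have hkFq := (Nat.div_add_mod' kF kI).symm
  have hqς : kF / kI ≤ ς := Nat.div_le_of_le_mul (by rwa [mul_comm])
  rw [Nat.lcm_comm] at hM
  have hmds : IsMDS (stdGen P kF nF) := isMDS_stdGen_mono hP hk hn.le (by omega)
  set r := nF - kF with hrdef
  set q := kF / kI with hq
  set b := numStripes kF kI with hb
  set s := numStripes kI kF % b with hsdef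
  set t := kF % kI with ht
  obtain ⟨PI, hPI⟩ := exists_splitPartition hs hsb.le htk hkFq hMI hM.symm
    (Nat.dvd_lcm_right kI kF) (Nat.dvd_lcm_left kI kF)
  -- A merged stripe is read through its own block. A residual stripe is read completely if `t ≤ r`;
  -- otherwise the nodes for block `q` and the scattered symbols are read, at most `r + (kI - t)`
  -- nodes.
  let D : Fin (Nat.lcm kI kF / kI) → Finset (Fin nI) := fun i =>
    if i.1 < q * b then Dr (i % q) else if t ≤ r then univ.image e
    else Dr q ∪ (univ.filter fun a : Fin kI => t ≤ a.1).image e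
  -- A residual stripe exists only if `t > 0`; then `q * kI < kF ≤ ς * kI`, so block `q` is
  -- available.
  have hqlt : ∀ i : Fin (Nat.lcm kI kF / kI), ¬ i.1 < q * b → q < ς := by
    intro i hi
    have htpos := pos_of_residual hs (i.2.trans_eq hMI) hi hkI
    have : q * kI < ς * kI := by omega
    exact Nat.lt_of_mul_lt_mul_right this
  have hmodlt : ∀ i : ℕ, i < q * b → i % q < ς := by
    intro i hi
    have hq0 : 0 < q := Nat.pos_of_ne_zero fun h => by simp [h] at hi
    exact (Nat.mod_lt i hq0).trans_le hqς
  have hmem : ∀ v : Fin (Nat.lcm kI kF / kF) × Fin nF, kF ≤ v.2.1 → ∀ i,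
      PI.restrict F i ((contiguousPartition (Nat.dvd_lcm_right kI kF)).vec (stdGen P kF nF) v) ∈
        Submodule.span F (G.col '' (D i : Set (Fin nI))) := by
    rintro ⟨j, c⟩ hc i
    dsimp only at hc
    have hcr : c.1 - kF < r := by have := c.2; omega
    set x := PI.restrict F i
      ((contiguousPartition (Nat.dvd_lcm_right kI kF)).vec (stdGen P kF nF) (j, c)) with hx
    have hval : ∀ a : Fin kI, x a = if splitStripe kI q b s t i a = j.1 then
        P (splitPos kI q b t i a) (c.1 - kF) else 0 := by
      intro a
      obtain ⟨h, h', hidx⟩ := hPI i a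
      rw [hx, StripePartition.restrict_apply, hidx, StripePartition.vec,
        StripePartition.extend_index]
      simp [Fin.ext_iff, Matrix.col, Matrix.transpose, stdGen, not_lt.2 hc]
    by_cases hi : i.1 < q * b
    · simp only [D, if_pos hi]
      by_cases hj : i.1 / q = j.1
      · convert hspan (i.1 % q) (hmodlt i hi) _ hcr using 1
        funext a
        rw [hval]
        simp [splitStripe, splitPos, hi, hj]
      · convert Submodule.zero_mem _
        funext a
        rw [hval]
        simp [splitStripe, hi, hj]
    · simp only [D, if_neg hi]
      by_cases htr : t ≤ r
      · rw [if_pos htr]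
        exact mem_span_systematic (t := 0) he (by simp) (by simp)
      · rw [if_neg htr]
        have hsys : ∀ a : Fin kI, t ≤ a.1 →
            e a ∈ Dr q ∪ (univ.filter fun a : Fin kI => t ≤ a.1).image e := fun a ha =>
          Finset.mem_union_right _ (Finset.mem_image_of_mem _ (by simpa using ha))
        by_cases hj : i.1 - q * b = j.1
        · have h1 := mem_span_systematic (t := t) he
            (x := x - fun a : Fin kI => P (q * kI + a) (c.1 - kF)) (fun a ha => by
              rw [Pi.sub_apply, hval]
              simp [splitStripe, splitPos, hi, hj, ha]) hsys
          have h2 := hspan q (hqlt i hi) _ hcr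
          have h3 := Submodule.add_mem _ h1 (Submodule.span_mono (Set.image_mono
            (Finset.coe_subset.2 (Finset.subset_union_left))) h2)
          rwa [sub_add_cancel] at h3
        · refine mem_span_systematic (t := t) he (fun a ha => ?_) hsys
          rw [hval]
          simp [splitStripe, hi, hj, ha]
  obtain ⟨C, h1, h2, h3⟩ := exists_systematic_convertibleCode hG he hmds PI
    (contiguousPartition (Nat.dvd_lcm_right kI kF)) (univ.filter fun w => w.2 ∈ D w.1) fun v hv => by
      have := PI.mem_span_vec (hmem v hv)
      simpa using this
  refine ⟨C, h1, ?_, h3⟩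
  rw [← C.sum_card_readIn]
  have hDi : ∀ i, C.readIn i = D i := by
    intro i
    ext c
    simp [ConvertibleCode.mem_readIn, h2]
  have hcard : ∀ i, (D i).card ≤ r + if i.1 < q * b then 0 else kI - max t r := by
    intro i
    by_cases hi : i.1 < q * b
    · simp only [D, if_pos hi]
      exact hDr _ (hmodlt i hi)
    · simp only [D, if_neg hi]
      by_cases htr : t ≤ r
      · rw [if_pos htr, max_eq_right htr]
        refine Finset.card_image_le.trans ?_
        rw [Finset.card_fin]
        omega
      · rw [if_neg htr, max_eq_left (by omega)]
        refine (Finset.card_union_le _ _).trans (Nat.add_le_add (hDr q (hqlt i hi))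
          (Finset.card_image_le.trans ?_))
        have := Finset.card_filter_add_card_filter_not (s := (univ : Finset (Fin kI)))
          (p := fun a : Fin kI => a.1 < t)
        rw [Fin.card_filter_val_lt, Finset.card_univ, Fintype.card_fin, min_eq_right htk.le] at this
        simp only [not_lt] at this
        omega
  refine (Finset.sum_le_sum fun i _ => (hDi i ▸ hcard i)).trans_eq ?_
  rw [Finset.sum_add_distrib, Finset.sum_const, Finset.card_univ, Fintype.card_fin, smul_eq_mul,
    Finset.sum_ite, Finset.sum_const_zero, zero_add, Finset.sum_const, smul_eq_mul]
  congr 2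
  have := Finset.card_filter_add_card_filter_not
    (s := (univ : Finset (Fin (Nat.lcm kI kF / kI)))) (p := fun i => i.1 < q * b)
  rw [Fin.card_filter_val_lt, Finset.card_univ, Fintype.card_fin] at this
  change Nat.lcm kI kF / kI = q * b + s at hMI
  omega

theorem exists_large_field (N : ℕ) :
    ∃ (F : Type u) (_ : Field F) (_ : Finite F), N < Nat.card F := by
  obtain ⟨p, hp, hprime⟩ := Nat.exists_infinite_primes (N + 1)
  have := Fact.mk hprime
  refine ⟨ULift.{u} (ZMod p), inferInstance, inferInstance, ?_⟩
  rw [Nat.card_ulift, Nat.card_zmod]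
  omega

/-! ### Attaining the bounds -/

section Attaining

variable {F : Type u} [Field F] {nI kI nF kF : ℕ}

/-- The data for converting by merging `ς` initial stripes with generator matrix `G`. -/
def HasMergeParities (G : Matrix (Fin kI) (Fin nI) F) (r ς : ℕ) : Prop :=
  ∃ (P : ℕ → ℕ → F) (D : ℕ → Finset (Fin nI)),
    IsMDS (stdGen P (ς * kI) (ς * kI + r)) ∧ (∀ l < ς, (D l).card ≤ r) ∧
      ∀ l < ς, ∀ v < r, (fun a : Fin kI => P (l * kI + a) v) ∈
        Submodule.span F (G.col '' (D l : Set (Fin nI)))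

/-- With the initial code prescribed, reading all message symbols requires only some final MDS code;
the cheaper regime requires merge parities. -/
theorem exists_convertibleCode_le_bounds {G : Matrix (Fin kI) (Fin nI) F} (hG : IsMDS G)
    (hs : IsSystematic G) (hkI : 0 < kI) (hkF : 0 < kF) (hnF : kF < nF)
    (hdef : nI - kI < nF - kF ∨ min kI kF ≤ nF - kF →
      ∃ H : Matrix (Fin kF) (Fin nF) F, IsMDS H)
    (hmerge : nF - kF ≤ nI - kI → nF - kF < kI → nF - kF < kF →
      ∃ ς, kF ≤ ς * kI ∧ HasMergeParities G (nF - kF) ς) :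
    ∃ C : ConvertibleCode F nI kI nF kF, C.initialGen = G ∧
      C.readSet.card ≤ readBound nI kI nF kF ∧ C.newNodes.card = writeBound kI nF kF := by
  unfold readBound writeBound
  split_ifs with h
  · obtain ⟨H, hH⟩ := hdef h
    exact exists_convertibleCode_card_readSet_le_lcm hG hs hH
  · push Not at h
    obtain ⟨ς, hς, P, D, hP, hD, hspan⟩ := hmerge h.1 (by omega) (by omega)
    obtain ⟨e, he⟩ := hs
    exact exists_convertibleCode_of_merge hG he hP hD hspan hkI hkF hς hnF (by omega)

theorem ConvertibleCode.isAccessOptimal_of_le_bounds (C : ConvertibleCode F nI kI nF kF)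
    (hne : kI ≠ kF) (hkI : 0 < kI) (hkF : 0 < kF) (hnF : kF < nF)
    (hread : C.readSet.card ≤ readBound nI kI nF kF)
    (hwrite : C.newNodes.card ≤ writeBound kI nF kF) : C.IsAccessOptimal := by
  intro K _ _ C'
  exact Nat.add_le_add (hread.trans (C'.readBound_le hne hkI hkF hnF))
    (hwrite.trans (C'.writeBound_le hne))

/-- The bounds are attained over large fields. -/
theorem exists_convertibleCode_eq_bounds (hkI : 0 < kI) (hkF : 0 < kF) (hnI : kI < nI)
    (hnF : kF < nF) (hne : kI ≠ kF) :
    ∃ (F : Type u) (_ : Field F) (_ : Finite F) (C : ConvertibleCode F nI kI nF kF),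
      C.readSet.card = readBound nI kI nF kF ∧ C.newNodes.card = writeBound kI nF kF := by
  classical
  obtain ⟨F, _, _, hF⟩ := exists_large_field.{u}
    (max (2 ^ (kF * kI + (nI - kI)) * (kF * kI)) (2 ^ (kF + (nF - kF)) * kF))
  obtain ⟨θ, hθ⟩ := exists_isMDS_powers (F := F) (Nat.mul_pos hkF hkI) (nI - kI)
    ((le_max_left _ _).trans_lt hF)
  obtain ⟨θ', hθ'⟩ := exists_isMDS_powers (F := F) hkF (nF - kF) ((le_max_right _ _).trans_lt hF)
  have hle : kI ≤ kF * kI := Nat.le_mul_of_pos_left _ hkF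
  have hG : IsMDS (stdGen (fun a v => θ v ^ a) kI nI) :=
    isMDS_stdGen_mono hθ hle hnI.le (by omega)
  have hs : IsSystematic (stdGen (fun a v => θ v ^ a) kI nI) := by
    refine ⟨Fin.castLE hnI.le, ?_⟩
    ext a c
    simp [stdGen, Matrix.one_apply, Fin.ext_iff]
  obtain ⟨C, -, h1, h2⟩ := exists_convertibleCode_le_bounds (nF := nF) (kF := kF) hG hs hkI hkF hnF
    (fun _ => ⟨_, isMDS_stdGen_mono hθ' le_rfl hnF.le (by omega)⟩) (fun hr _ _ => by
      -- Any number of blocks with `kF ≤ ς * kI` would do; `ς = kF` is a convenient choice. All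
      -- blocks use the same first `nF - kF` parities of the initial code.
      refine ⟨kF, Nat.le_mul_of_pos_right _ hkI, fun a v => θ v ^ a,
        fun _ => univ.filter fun c => kI ≤ c.1 ∧ c.1 < kI + (nF - kF),
        isMDS_stdGen_mono hθ le_rfl (by omega) (by omega), fun l _ => ?_, fun l _ v hv => ?_⟩
      · have : (univ.filter fun c : Fin nI => kI ≤ c.1 ∧ c.1 < kI + (nF - kF)).card ≤
            (Finset.Ico kI (kI + (nF - kF))).card := by
          refine Finset.card_le_card_of_injOn Fin.val (fun c hc => ?_) Fin.val_injective.injOn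
          simpa using hc
        simpa using this
      -- A block of a column of powers is a scalar multiple of its first block.
      · have : (fun a : Fin kI => θ v ^ (l * kI + a.1)) = θ v ^ (l * kI) •
            (stdGen (fun a v => θ v ^ a) kI nI).col ⟨kI + v, by omega⟩ := by
          funext a
          simp [stdGen, Matrix.col, Matrix.transpose, pow_add]
        rw [this]
        exact Submodule.smul_mem _ _ (Submodule.subset_span ⟨_, by simp [hv], rfl⟩))
  exact ⟨F, _, ‹_›, C, h1.antisymm (C.readBound_le hne hkI hkF hnF), h2⟩

/-- The parities of a systematic MDS code serve for converting a single stripe. -/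
theorem IsMDS.hasMergeParities_one {G : Matrix (Fin kI) (Fin nI) F} (hG : IsMDS G)
    (hs : IsSystematic G) {r : ℕ} (hr : r ≤ nI - kI) : HasMergeParities G r 1 := by
  classical
  obtain ⟨e, he⟩ := hs
  have := hG.1
  obtain ⟨f, hf, hef⟩ := exists_parity_positions (e := e) (r := r) (by omega)
  obtain ⟨P, hP⟩ := exists_array fun a v => G a (f v)
  refine ⟨P, fun _ => univ.image f, ?_, fun _ _ => ?_, fun l hl v hv => ?_⟩
  · rw [one_mul]
    exact hG.stdGen_of_systematic he hf hef P hP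
  · exact Finset.card_image_le.trans_eq (Finset.card_fin r)
  · obtain rfl : l = 0 := by omega
    refine Submodule.subset_span ⟨f ⟨v, hv⟩, by simp, ?_⟩
    funext a
    rw [zero_mul, zero_add]
    exact (hP a ⟨v, hv⟩).symm

/-- Systematic MDS codes can be converted optimally to smaller dimension. -/
theorem accessOptimallyConvertible_of_lt {G : Matrix (Fin kI) (Fin nI) F} (hG : IsMDS G)
    (hs : IsSystematic G) (hkF : 0 < kF) (hnF : kF < nF) (hlt : kF < kI)
    (hH : nI - kI < nF - kF → ∃ H : Matrix (Fin kF) (Fin nF) F, IsMDS H) :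
    AccessOptimallyConvertible G nF kF := by
  obtain ⟨C, h1, h2, h3⟩ := exists_convertibleCode_le_bounds hG hs (hkF.trans hlt) hkF hnF
    (fun _ => by
      by_cases hr : nI - kI < nF - kF
      · exact hH hr
      · obtain ⟨P, hP⟩ := hG.exists_stdGen
        have := hG.1
        exact ⟨_, isMDS_stdGen_mono hP hlt.le hnF.le (by omega)⟩)
    fun hr _ _ => ⟨1, by omega, hG.hasMergeParities_one hs hr⟩
  exact ⟨C, h1, C.isAccessOptimal_of_le_bounds hlt.ne' (hkF.trans hlt) hkF hnF h2 h3.le⟩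

/-- Puncturing, or lengthening over a large field, converts without changing the dimension. -/
theorem accessOptimallyConvertible_of_eq [Finite F] {k : ℕ} {G : Matrix (Fin k) (Fin nI) F}
    (hG : IsMDS G) (hk : 0 < k) (hnF : k < nF)
    (hF : nI < nF → (nF - 1).choose (k - 1) < Nat.card F) :
    AccessOptimallyConvertible G nF k := by
  classical
  have h1 : Nat.lcm k k / k = 1 := by rw [Nat.lcm_self, Nat.div_self hk]
  let P := contiguousPartition (Nat.dvd_lcm_left k k)
  rcases le_or_gt nF nI with hn | hn
  · have hH : IsMDS (G.submatrix id (Fin.castLE hn)) := by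
      refine ⟨hnF.le, fun s hs => ?_⟩
      have h := hG.linearIndepOn (s := s.map (Fin.castLEEmb hn)) (by simp [hs])
      rw [Finset.coe_map] at h
      exact LinearIndepOn.comp_of_image h (Fin.castLE_injective hn).injOn
    obtain ⟨C, hC, hD, hsrc⟩ := exists_convertibleCode hG hH P P
      (fun v => some (v.1, Fin.castLE hn v.2)) (fun v v' w h h' => by
        have := h.trans h'.symm
        simp only [Option.some.injEq, Prod.mk.injEq] at this
        exact Prod.ext this.1 (Fin.castLE_injective hn this.2)) ∅ (fun v w h => by
        obtain rfl := Option.some.inj h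
        rfl) (fun v h => by simp at h)
    refine ⟨C, hC, fun K _ _ C' => ?_⟩
    have : C.accessCost = 0 := by
      simp [ConvertibleCode.accessCost, ConvertibleCode.newNodes, hD, hsrc]
    omega
  · obtain ⟨H, hH, hHG⟩ := hG.exists_extension hk hn.le (hF hn)
    let S : Finset (Fin nI) := univ.filter fun c => c.1 < k
    have hS : S.card = k := by
      rw [Fin.card_filter_val_lt, min_eq_right hG.1]
    have hspan : ∀ x, x ∈ Submodule.span F (P.vec G '' (univ ×ˢ S :
        Finset (Fin (Nat.lcm k k / k) × Fin nI))) := by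
      intro x
      refine Submodule.span_mono ?_ (P.mem_span_vec (G := G) (D := fun _ => S) fun i => ?_)
      · apply Set.image_mono
        intro w hw
        exact Finset.mem_coe.2 (Finset.mem_product.2 ⟨mem_univ _, hw⟩)
      · rw [hG.span_col_eq_top hS.ge]
        trivial
    obtain ⟨C, hC, hD, hsrc⟩ := exists_convertibleCode hG hH P P
      (fun v => if h : v.2.1 < nI then some (v.1, ⟨v.2.1, h⟩) else none) (fun v v' w h h' => by
        have := h.trans h'.symm
        split_ifs at h h' with h2 h2'
        simp only [dif_pos h2, dif_pos h2', Option.some.injEq, Prod.mk.injEq, Fin.mk.injEq] at this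
        exact Prod.ext this.1 (Fin.ext this.2)) (univ ×ˢ S) (fun v w h => by
        split_ifs at h with h2
        obtain rfl := Option.some.inj h
        rw [StripePartition.vec, StripePartition.vec, ← hHG]
        rfl) fun v _ => hspan _
    refine ⟨C, hC, fun K _ _ C' => le_trans (le_of_eq ?_) (C'.add_le_accessCost hk hn)⟩
    have hnew : C.newNodes = univ ×ˢ (univ.filter fun c : Fin nF => ¬ c.1 < nI) := by
      ext v
      simp [ConvertibleCode.newNodes, hsrc]
    have hcount := Finset.card_filter_add_card_filter_not (s := (univ : Finset (Fin nF)))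
      (p := fun c : Fin nF => c.1 < nI)
    rw [Fin.card_filter_val_lt, Finset.card_univ, Fintype.card_fin, min_eq_right hn.le] at hcount
    rw [ConvertibleCode.accessCost, hD, hnew, Finset.card_product, Finset.card_product,
      Finset.card_univ, Fintype.card_fin, hS, h1, one_mul, one_mul]
    omega

end Attaining

/-! ### Rigidity of access-optimal merging codes -/

/-- An optimal systematic code for merging `ς` stripes has its structure forced. -/
theorem ConvertibleCode.hasMergeParities {F : Type u} [Field F] {nI kI r ς : ℕ}
    (C : ConvertibleCode F nI kI (ς * kI + r) (ς * kI)) (hC : C.IsAccessOptimal)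
    (hs : IsSystematic C.finalGen) (hς : 2 ≤ ς) (hkI : 0 < kI) (hnI : kI < nI) (hr0 : 0 < r)
    (hrI : r ≤ nI - kI) (hr : r < kI) : HasMergeParities C.initialGen r ς := by
  classical
  have hςk : 0 < ς * kI := Nat.mul_pos (by omega) hkI
  have hlt : kI < ς * kI := by nlinarith
  have hlcm : Nat.lcm kI (ς * kI) = ς * kI := Nat.lcm_eq_right (Nat.dvd_mul_left kI ς)
  have hlenI : Nat.lcm kI (ς * kI) / kI = ς := by rw [hlcm, Nat.mul_div_cancel _ hkI]
  have hlenF : Nat.lcm kI (ς * kI) / (ς * kI) = 1 := by rw [hlcm, Nat.div_self hςk]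
  have hnum : numStripes (ς * kI) kI = 1 := by rw [numStripes, Nat.lcm_comm, hlenF]
  have hwb : writeBound kI (ς * kI + r) (ς * kI) = r := by
    rw [writeBound, hnum, one_mul, Nat.add_sub_cancel_left]
  have hrb : readBound nI kI (ς * kI + r) (ς * kI) = ς * r := by
    rw [readBound, if_neg (by rw [Nat.add_sub_cancel_left, min_eq_left hlt.le]; omega), hnum,
      Nat.mod_one, zero_mul, add_zero, Nat.add_sub_cancel_left, numStripes, hlenI]
  obtain ⟨K, _, _, C', h1, h2⟩ := exists_convertibleCode_eq_bounds.{u} (nI := nI) hkI hςk hnI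
    (show ς * kI < ς * kI + r by omega) hlt.ne
  -- Some field attains both bounds at once, so the optimal cost is their sum, and a code of that
  -- cost must meet each bound with equality.
  have hcost := hC K C'
  have hread := C.readBound_le hlt.ne hkI hςk (by omega)
  have hwrite := C.writeBound_le hlt.ne
  rw [accessCost, accessCost, h1, h2] at hcost
  have hreadc : C.readSet.card = ς * r := by omega
  have hnewc : C.newNodes.card = r := by omega
  have hj : ∀ j j' : Fin (Nat.lcm kI (ς * kI) / (ς * kI)), j = j' := fun j j' => by ext; omega
  let j : Fin (Nat.lcm kI (ς * kI) / (ς * kI)) := ⟨0, by omega⟩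
  have hDi : ∀ i, (C.readIn i).card = r := by
    have hle : ∀ i, r ≤ (C.readIn i).card := fun i => by
      obtain ⟨j', h, -⟩ := C.exists_le_card_readIn hlt.ne hkI hςk (by omega) i
      have := C.card_overlap_le_left i j'
      omega
    have hsum := C.sum_card_readIn
    have heq : ∑ i : Fin (Nat.lcm kI (ς * kI) / kI), r = ∑ i, (C.readIn i).card := by
      rw [hsum, hreadc, Finset.sum_const, Finset.card_univ, Fintype.card_fin, hlenI, smul_eq_mul]
    intro i
    exact ((Finset.sum_eq_sum_iff_of_le fun i _ => hle i).1 heq i (mem_univ i)).symm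
  have hnewj : #{c' | (C.source (j, c')).isNone} = r := by
    have h := C.sum_card_newNodes.trans hnewc
    rwa [Fintype.sum_eq_single j fun j' h => (h (hj _ _)).elim] at h
  have hkept : ∀ i, (C.keptTo i j).card = kI := by
    have hle : ∀ i, (C.keptTo i j).card ≤ kI := fun i =>
      (C.card_keptTo_le hlt.ne i j).trans (C.card_overlap_le_left i j)
    have hsum := C.card_newNodes j
    have heq : ∑ i, (C.keptTo i j).card = ∑ i : Fin (Nat.lcm kI (ς * kI) / kI), kI := by
      have hconst : ∑ i : Fin (Nat.lcm kI (ς * kI) / kI), kI = ς * kI := by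
        rw [Finset.sum_const, Finset.card_univ, Fintype.card_fin, smul_eq_mul, hlenI]
      omega
    intro i
    exact (Finset.sum_eq_sum_iff_of_le fun i _ => hle i).1 heq i (mem_univ i)
  obtain ⟨e, he⟩ := hs
  -- Stripe `i` already contributes `kI` kept nodes. A new systematic node carrying one of its
  -- symbols would make `kI + 1 ≤ ς * kI` independent vectors supported on `kI` coordinates. Hence
  -- all new nodes are parities.
  have hnewne : ∀ b c', C.source (j, c') = none → e b ≠ c' := by
    rintro b _ hc rfl
    set i := (C.initialPart.index.symm (C.finalPart.index (j, b))).1 with hi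
    have hnot : e b ∉ C.keptTo i j := fun h => by
      obtain ⟨c, h⟩ := C.mem_keptTo.1 h
      simp [hc] at h
    have hcard : (insert (e b) (C.keptTo i j)).card = kI + 1 := by
      rw [Finset.card_insert_of_notMem hnot, hkept]
    have := card_le_of_linearIndepOn_of_support
      (C.finalPart.linearIndepOn_vec C.final_mds j (s := insert (e b) (C.keptTo i j))
        (hcard.trans_le hlt)) (A := univ.filter fun p => (C.initialPart.index.symm p).1 = i)
      fun c' hc' p hp => by
        have hp' : (C.initialPart.index.symm p).1 ≠ i := by simpa using hp
        rcases Finset.mem_insert.1 hc' with rfl | hc'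
        · rw [StripePartition.vec, col_of_submatrix_eq_one he, StripePartition.extend_single,
            Pi.single_eq_of_ne]
          rintro rfl
          exact hp' hi.symm
        · obtain ⟨c, hc'⟩ := C.mem_keptTo.1 hc'
          rw [C.vec_eq_of_source hc', StripePartition.vec, StripePartition.extend_apply,
            if_neg hp']
    rw [hcard, C.initialPart.card_block i] at this
    omega
  let f : Fin r → Fin (ς * kI + r) := fun v =>
    (univ.filter fun c' => (C.source (j, c')).isNone).orderEmbOfFin hnewj v
  have hfnone : ∀ v, C.source (j, f v) = none := fun v => by
    have := Finset.orderEmbOfFin_mem _ hnewj v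
    exact Option.isNone_iff_eq_none.1 (Finset.mem_filter.1 this).2
  have hf : Function.Injective f := fun v v' h => by simpa [f] using h
  -- Reorders the final message coordinates so that the symbols of each initial stripe become `kI`
  -- consecutive rows.
  let g : Fin (ς * kI) → Fin (ς * kI) := fun a => (C.finalPart.index.symm (C.initialPart.index
    (⟨a / kI, (Nat.div_lt_of_lt_mul (mul_comm ς kI ▸ a.2)).trans_eq hlenI.symm⟩,
      ⟨a % kI, Nat.mod_lt _ hkI⟩))).2
  have hg : Function.Injective g := by
    intro a a' h
    have h2 := C.initialPart.index.injective
      (C.finalPart.index.symm.injective (Prod.ext (hj _ _) h))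
    simp only [Prod.mk.injEq, Fin.mk.injEq] at h2
    ext
    rw [← Nat.div_add_mod a.1 kI, h2.1, h2.2, Nat.div_add_mod]
  let σ : Fin (ς * kI) ≃ Fin (ς * kI) :=
    Equiv.ofBijective g (Finite.injective_iff_bijective.1 hg)
  obtain ⟨P, hP⟩ := exists_array fun (a : Fin (ς * kI)) v => C.finalGen (σ a) (f v)
  refine ⟨P, fun l => if h : l < Nat.lcm kI (ς * kI) / kI then C.readIn ⟨l, h⟩ else ∅, ?_,
    fun l hl => ?_, fun l hl v hv => ?_⟩
  · refine (C.final_mds.submatrix_equiv σ).stdGen_of_systematic (e := e ∘ σ) ?_ hf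
      (fun a v => hnewne _ _ (hfnone v)) P hP
    ext a b
    simp [entry_of_submatrix_eq_one he, Matrix.one_apply]
  · dsimp only
    rw [dif_pos (hl.trans_eq hlenI.symm), hDi]
  · dsimp only
    rw [dif_pos (hl.trans_eq hlenI.symm)]
    convert C.restrict_vec_mem_span (hfnone ⟨v, hv⟩) ⟨l, hl.trans_eq hlenI.symm⟩ using 1
    funext a
    have hlt' : l * kI + a < ς * kI := by
      have := Nat.mul_le_mul_right kI (Nat.succ_le_of_lt hl)
      rw [Nat.succ_mul] at this
      omega
    rw [hP ⟨l * kI + a, hlt'⟩ ⟨v, hv⟩]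
    have hidx : C.initialPart.index (⟨l, hl.trans_eq hlenI.symm⟩, a) =
        C.finalPart.index (j, σ ⟨l * kI + a, hlt'⟩) := by
      rw [← Equiv.symm_apply_eq]
      refine Prod.ext (hj _ _) ?_
      have e1 : (l * kI + a) / kI = l := by
        rw [mul_comm, Nat.mul_add_div hkI, Nat.div_eq_of_lt a.2, add_zero]
      have e2 : (l * kI + a) % kI = a := by
        rw [mul_comm, Nat.mul_add_mod, Nat.mod_eq_of_lt a.2]
      simp [σ, g, e1, e2]
    rw [StripePartition.restrict_apply, hidx, StripePartition.vec, StripePartition.extend_index,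
      if_pos rfl]
    rfl

end ConvertibleCodes

open ConvertibleCodes in
theorem mainTheorem2 (nI kI nF kF : ℕ) (hkI : 0 < kI) (hkF : 0 < kF)
    (hnI : kI < nI) (hnF : kF < nF) :
    -- every systematic MDS code is access-optimally convertible if `kF ≤ kI`
    (∀ (F : Type u) [Field F] [Finite F] (G : Matrix (Fin kI) (Fin nI) F),
      IsMDS G → IsSystematic G → kF ≤ kI →
      (kF < kI → nI - kI < nF - kF → ∃ H : Matrix (Fin kF) (Fin nF) F, IsMDS H) →
      (kF = kI → nI < nF → (nF - 1).choose (kF - 1) < Nat.card F) →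
      AccessOptimallyConvertible G nF kF) ∧
    -- the initial code of an access-optimal systematic merge-regime code with the same number
    -- `nF - kF` of final parities is access-optimally convertible if `kF ≤ ς * kI`
    (∀ (F : Type u) [Field F] [Finite F] (ς : ℕ), 2 ≤ ς → kF ≤ ς * kI →
      ∀ C : ConvertibleCode F nI kI (ς * kI + (nF - kF)) (ς * kI),
      C.IsAccessOptimal → IsSystematic C.initialGen → IsSystematic C.finalGen →
      (kF = kI → nI < nF → (nF - 1).choose (kF - 1) < Nat.card F) →
      AccessOptimallyConvertible C.initialGen nF kF) ∧
    -- the lower bounds on the access cost hold and are attained simultaneously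
    (kI ≠ kF →
      (∀ (F : Type u) [Field F] [Finite F] (C : ConvertibleCode F nI kI nF kF),
        readBound nI kI nF kF ≤ C.readSet.card ∧ writeBound kI nF kF ≤ C.newNodes.card) ∧
      (∃ (F : Type u) (_ : Field F) (_ : Finite F) (C : ConvertibleCode F nI kI nF kF),
        C.readSet.card = readBound nI kI nF kF ∧
        C.newNodes.card = writeBound kI nF kF)) := by
  refine ⟨fun F _ _ G hG hs hle hH hF => ?_, fun F _ _ ς hς hkς C hC hsI hsF hF => ?_,
    fun hne => ⟨fun F _ _ C => ⟨C.readBound_le hne hkI hkF hnF, C.writeBound_le hne⟩,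
      exists_convertibleCode_eq_bounds hkI hkF hnI hnF hne⟩⟩
  · rcases hle.lt_or_eq with hlt | rfl
    · exact accessOptimallyConvertible_of_lt hG hs hkF hnF hlt (hH hlt)
    · exact accessOptimallyConvertible_of_eq hG hkI hnF (hF rfl)
  -- Shortening the final code of the merging conversion keeps its `nF - kF` parities and yields the
  -- code required over the same field.
  · have hH : ∃ H : Matrix (Fin kF) (Fin nF) F, IsMDS H := by
      obtain ⟨P, hP⟩ := C.final_mds.exists_stdGen
      exact ⟨_, isMDS_stdGen_mono hP hkς hnF.le (by omega)⟩
    rcases lt_trichotomy kF kI with hlt | rfl | hlt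
    · exact accessOptimallyConvertible_of_lt C.initial_mds hsI hkF hnF hlt fun _ => hH
    · exact accessOptimallyConvertible_of_eq C.initial_mds hkI hnF (hF rfl)
    · obtain ⟨C', h1, h2, h3⟩ := exists_convertibleCode_le_bounds C.initial_mds hsI hkI hkF hnF
        (fun _ => hH) fun hrI hr _ =>
          ⟨ς, hkς, C.hasMergeParities hC hsF hς hkI hnI (by omega) hrI hr⟩
      exact ⟨C', h1, C'.isAccessOptimal_of_le_bounds hlt.ne hkI hkF hnF h2 h3.le⟩
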